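/- **Setting.** There are $M$ agents with dynamics $x^i_{t+1}=A^ix^i_t+B^iu^i_t+d^i_t$, where $x^i_t\in\mathbb R^{n^i}$ and $u^i_t\in\mathbb R^{m^i}$; stacked, $x_{t+1}=Ax_t+Bu_t+d_t$. Let $\mathcal U^i=\{v: C_u^iv\le c_u^i\}$, $\mathcal X^i=\{z: C_x^iz\le c_x^i\}$, $\mathcal X^i_f=\{z: C_N^iz\le c_N^i\}$, let $N\ge1$ be a horizon, $\bar b\in\mathbb R^p$, and let $Q^i,R^i,P^i$ be weights. Let $\Gamma_N$ be the set of all $x=(x^1,\dots,x^M)$ for which there are $\xi^i_0,\dots,\xi^i_N$ and $\nu^i_0,\dots,\nu^i_{N-1}$ with $\xi^i_0=x^i$, $\xi^i_N\in\mathcal X^i_f$ and, for $0\le k<N$, $\xi^i_{k+1}=A^i\xi^i_k+B^i\nu^i_k$, $\nu^i_k\in\mathcal U^i$, $\xi^i_k\in\mathcal X^i$, $\sum_i(E_u^i\nu^i_k+E_x^i\xi^i_k)\le\bar b$. Assume for all $i$: $(A^i,B^i)$ is stabilizable; $0$ is an interior point of $\mathcal X^i$ and of $\mathcal U^i$; $Q^i,R^i,P^i$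 are symmetric positive definite; there is $K^i\in\mathbb R^{m^i\times n^i}$ such that $(A^i-B^iK^i)\mathcal X_f^i\subseteq\mathcal X_f^i\subseteq\mathcal X^i$, $-K^i\mathcal X_f^i\subseteq\mathcal U^i$ and $\|(A^i-B^iK^i)z\|_{P^i}^2-\|z\|_{P^i}^2\le-\|z\|^2_{Q^i+(K^i)^\top R^iK^i}$ for all $z\in\mathbb R^{n^i}$. Assume also $\bar b>0$ componentwise and $0\in\operatorname{int}\Gamma_N$. **Condensed data.** For $u^i=(\nu^i_0,\dots,\nu^i_{N-1})$ and $x^i$, eliminating $\xi^i$ through the dynamics gives the cost $$f^i(u^i,x^i)=\tfrac12\Big(\|\xi^i_N\|^2_{P^i}+\sum_{k<N}\big(\|\xi^i_k\|^2_{Q^i}+\|\nu^i_k\|^2_{R^i}\big)\Big)=\tfrac12(u^i)^\top H^iu^i+(u^i)^\top G^ix^i+\tfrac12(x^i)^\top W^ix^i,$$ the polyhedron $\mathcal Z^i(x^i)=\{u^i: D^ix^i+C^iu^i\le c^i\}$ encoding $\nu^i_k\in\mathcal U^i$, $\xi^i_k\in\mathcal X^i$ $(0\le k<N)$ and $\xi^i_N\in\mathcal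 X^i_f$, and the coupling constraints in the form $\sum_i(F^ix^i+E^iu^i)\le b=(\bar b,\dots,\bar b)\in\mathbb R^{Np}$. For $\epsilon>0$ let $h^i(\cdot,x^i)=f^i(\cdot,x^i)+\mathcal I_{\mathcal Z^i(x^i)}$ and $\mathcal E(x)=\{y:\sum_iF^ix^i+y\le b\}$, and let $S^d_\epsilon(x)$ be the minimizer over $\lambda\in\mathbb R^{Np}$ of $\sum_i(h^i(\cdot,x^i))^*(-(E^i)^\top\lambda)+\frac\epsilon2\|\lambda\|^2+\mathcal I^*_{\mathcal E(x)}(\lambda)$. Put $L_{\varphi_\epsilon}=\epsilon+\sqrt{\sum_i\|E^i(H^i)^{-1}(E^i)^\top\|^2}$ (spectral norms), $\hat u^i(\lambda,x^i)=\arg\min_{v\in\mathcal Z^i(x^i)}\big(f^i(v,x^i)+\lambda^\top E^iv\big)$, let $q(\lambda,x)$ collect the stage-$0$ components of $\hat u^1,\dots,\hat u^M$, and let $\kappa_\epsilon(x)=q(S^d_\epsilon(x),x)$. **Algorithm.** With step size $\alpha>0$, $\mathcal T^\ell(\lambda,x)=\lambda_\ell$ is the output of $\ell$ communication rounds $$\mu_{j+1}=\max\Big\{0,\lambda_j+\alpha\Big(\sum_i\big(F^ix^i+E^i\hat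 u^i(\lambda_j,x^i)\big)-b-\epsilon\lambda_j\Big)\Big\},\quad\theta_{j+1}=\tfrac12\Big(1+\sqrt{1+4\theta_j^2}\Big),\quad\lambda_{j+1}=\mu_{j+1}+\tfrac{\theta_j-1}{\theta_{j+1}}(\mu_{j+1}-\mu_j)$$ started at $\lambda_0=\mu_0=\lambda$, $\theta_0=1$. **Closed loop.** The interconnection $x_{t+1}=Ax_t+Bq(\lambda_t,x_t)+d_t$, $\lambda_{t+1}=\mathcal T^\ell(\lambda_t,x_{t+1})$ is written with $e_t=\lambda_t-S^d_\epsilon(x_t)$ as $$x_{t+1}=Ax_t+B(\kappa_\epsilon(x_t)+\delta u_t)+d_t,\qquad e_{t+1}=\mathcal T^\ell(e_t+S^d_\epsilon(x_t),x_t+\Delta x_t)-S^d_\epsilon(x_t+\Delta x_t),$$ where $\delta u_t=q(e_t+S^d_\epsilon(x_t),x_t)-q(S^d_\epsilon(x_t),x_t)$ and $\Delta x_t=(A-I)x_t+B(\kappa_\epsilon(x_t)+\delta u_t)+d_t$. Norms are Euclidean, $\|d\|_\infty=\sup_t\|d_t\|$. **Theorem (ISS of the plant–algorithm interconnection).** There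 is $\tilde\epsilon>0$ such that: (a) there are $\gamma_1,\sigma_1>0$ and $\beta_1\in\mathcal{KL}$ such that for every $\epsilon\in(0,\tilde\epsilon]$ there is $\rho>0$ such that all trajectories of $x_{t+1}=Ax_t+B(\kappa_\epsilon(x_t)+\delta u_t)+d_t$ with arbitrary inputs $\delta u,d$ and with $\|x_0\|,\|\delta u\|_\infty,\|d\|_\infty\le\rho$ satisfy $x_t\in\Gamma_N$ and $\|x_t\|\le\beta_1(\|x_0\|,t)+\gamma_1\|\delta u\|_\infty+\sigma_1\|d\|_\infty$ for all $t\ge0$; (b) for every $\epsilon\in(0,\tilde\epsilon]$ and every $\alpha\in(0,1/L_{\varphi_\epsilon})$ there is a finite $\ell^*>0$ such that for every number of rounds $\ell\ge\ell^*$ with $\ell>\frac2{\sqrt{\alpha\epsilon}}-1$ the closed loop keeps $x_t\in\Gamma_N$ and is locally input-to-state stable with respect to $d$: there are $\rho>0$, $\beta\in\mathcal{KL}$, $\gamma\in\mathcal K$ such that all closed-loop trajectories with $\|(x_0,e_0)\|\le\rho$ and $\|d\|_\infty\le\rho$ satisfy, for all $t\ge0$, $x_t\in\Gamma_N$ and $\|(x_t,e_t)\|\le\beta(\|(x_0,e_0)\|,t)+\gamma(\|d\|_\infty)$.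 -/

import Mathlib

open Matrix Set Filter Topology

/-- Class `𝒦`: continuous, strictly increasing functions on `[0, ∞)` that vanish at `0`. -/
def ClassK (γ : ℝ → ℝ) : Prop :=
  ContinuousOn γ (Ici 0) ∧ StrictMonoOn γ (Ici 0) ∧ γ 0 = 0

/-- Class `ℒ`: continuous, strictly decreasing functions on `[0, ∞)` that tend to `0`. -/
def ClassL (σ : ℝ → ℝ) : Prop :=
  ContinuousOn σ (Ici 0) ∧ StrictAntiOn σ (Ici 0) ∧ Tendsto σ atTop (𝓝 0)

/-- Class `𝒦ℒ` (the `ℒ` condition in the second argument is for `r > 0`; `β 0 s = 0` anyway). -/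
def ClassKL (β : ℝ → ℝ → ℝ) : Prop :=
  (∀ s, 0 ≤ s → ClassK fun r => β r s) ∧ ∀ r, 0 < r → ClassL (β r)

/-- A minimizer of `f` over `s` (an arbitrary point if there is none). -/
noncomputable def argminOn {V R : Type*} [Nonempty V] [Preorder R] (s : Set V) (f : V → R) : V :=
  Classical.epsilon fun v => v ∈ s ∧ IsMinOn f s v

/-- Fenchel conjugate of an extended-real-valued function on `ℝ^ι`. -/
noncomputable def fenchelConj {ι : Type*} [Fintype ι] (h : (ι → ℝ) → EReal) (μ : ι → ℝ) : EReal :=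
  ⨆ v : ι → ℝ, ((μ ⬝ᵥ v : ℝ) : EReal) - h v

/-- Indicator function of a set, in the sense of convex analysis. -/
noncomputable def cvxIndicator {V : Type*} (s : Set V) (v : V) : EReal :=
  open Classical in if v ∈ s then 0 else ⊤

/-- The pair `(A, B)` is stabilizable (in discrete time): some `A - B K` has all its complex
eigenvalues in the open unit disc. -/
def Stabilizable {a b : ℕ} (A : Matrix (Fin a) (Fin a) ℝ) (B : Matrix (Fin a) (Fin b) ℝ) : Prop :=
  ∃ K : Matrix (Fin b) (Fin a) ℝ,
    ∀ z ∈ spectrum ℂ ((A - B * K).map (algebraMap ℝ ℂ)), ‖z‖ < 1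

/-- Data of the multi-agent control problem: `M` agents with linear dynamics, polyhedral local
constraints, terminal sets and weights; `p` coupling constraints; a horizon `N ≥ 1`. -/
structure DMPC where
  /-- number of agents -/
  M : ℕ
  /-- horizon length -/
  N : ℕ
  N_pos : 0 < N
  /-- number of coupling constraints -/
  p : ℕ
  /-- state dimensions -/
  n : Fin M → ℕ
  /-- input dimensions -/
  m : Fin M → ℕ
  /-- numbers of local input, state and terminal inequalities -/
  ru : Fin M → ℕ
  rx : Fin M → ℕ
  rf : Fin M → ℕ
  A : ∀ i, Matrix (Fin (n i)) (Fin (n i)) ℝ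
  B : ∀ i, Matrix (Fin (n i)) (Fin (m i)) ℝ
  Cu : ∀ i, Matrix (Fin (ru i)) (Fin (m i)) ℝ
  cu : ∀ i, Fin (ru i) → ℝ
  Cx : ∀ i, Matrix (Fin (rx i)) (Fin (n i)) ℝ
  cx : ∀ i, Fin (rx i) → ℝ
  Cf : ∀ i, Matrix (Fin (rf i)) (Fin (n i)) ℝ
  cf : ∀ i, Fin (rf i) → ℝ
  Eu : ∀ i, Matrix (Fin p) (Fin (m i)) ℝ
  Ex : ∀ i, Matrix (Fin p) (Fin (n i)) ℝ
  bbar : Fin p → ℝ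
  Q : ∀ i, Matrix (Fin (n i)) (Fin (n i)) ℝ
  R : ∀ i, Matrix (Fin (m i)) (Fin (m i)) ℝ
  P : ∀ i, Matrix (Fin (n i)) (Fin (n i)) ℝ

namespace DMPC

variable (S : DMPC)

/-! ### Spaces, norms and constraint sets -/

/-- Stacked states `x = (x¹, …, x^M)`. -/
abbrev State : Type := ∀ i : Fin S.M, Fin (S.n i) → ℝ

/-- Stacked inputs `u = (u¹, …, u^M)`. -/
abbrev Input : Type := ∀ i : Fin S.M, Fin (S.m i) → ℝ

/-- Input trajectories of agent `i` over the horizon; the pair `(a, k)` is component `a` at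
stage `k`. -/
abbrev Traj (i : Fin S.M) : Type := Fin (S.m i) × Fin S.N → ℝ

/-- Dual variables of the coupling constraints over the horizon. -/
abbrev Dual : Type := Fin S.p × Fin S.N → ℝ

/-- Euclidean norms. -/
noncomputable def stateNorm (x : S.State) : ℝ := √(∑ i, ∑ a, x i a ^ 2)

noncomputable def inputNorm (u : S.Input) : ℝ := √(∑ i, ∑ a, u i a ^ 2)

noncomputable def dualNorm (e : S.Dual) : ℝ := √(∑ j, e j ^ 2)

/-- Euclidean norm of the pair `(x, e)`. -/
noncomputable def pairNorm (x : S.State) (e : S.Dual) : ℝ :=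
  √(S.stateNorm x ^ 2 + S.dualNorm e ^ 2)

def inputSet (i : Fin S.M) : Set (Fin (S.m i) → ℝ) := {v | S.Cu i *ᵥ v ≤ S.cu i}

def stateSet (i : Fin S.M) : Set (Fin (S.n i) → ℝ) := {z | S.Cx i *ᵥ z ≤ S.cx i}

def terminalSet (i : Fin S.M) : Set (Fin (S.n i) → ℝ) := {z | S.Cf i *ᵥ z ≤ S.cf i}

/-- `(ξ, ν)` satisfies the constraints of the optimal control problem with parameter `x`. -/
def Feasible (x : S.State) (ξ : ∀ i, Fin (S.N + 1) → Fin (S.n i) → ℝ)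
    (ν : ∀ i, Fin S.N → Fin (S.m i) → ℝ) : Prop :=
  (∀ i k, ξ i k.succ = S.A i *ᵥ ξ i k.castSucc + S.B i *ᵥ ν i k) ∧
  (∀ i, ξ i 0 = x i ∧ ξ i (Fin.last S.N) ∈ S.terminalSet i) ∧
  (∀ i k, ν i k ∈ S.inputSet i ∧ ξ i k.castSucc ∈ S.stateSet i) ∧
  ∀ k, ∑ i, (S.Eu i *ᵥ ν i k + S.Ex i *ᵥ ξ i k.castSucc) ≤ S.bbar

/-- `Γ_N`: the parameters for which the optimal control problem is feasible. -/
def feasibleSet : Set S.State := {x | ∃ ξ ν, S.Feasible x ξ ν}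

/-- Standing assumptions of the control problem. -/
structure Assumptions : Prop where
  stabilizable : ∀ i, Stabilizable (S.A i) (S.B i)
  zero_mem_stateSet : ∀ i, (0 : Fin (S.n i) → ℝ) ∈ interior (S.stateSet i)
  zero_mem_inputSet : ∀ i, (0 : Fin (S.m i) → ℝ) ∈ interior (S.inputSet i)
  Q_posDef : ∀ i, (S.Q i).PosDef
  R_posDef : ∀ i, (S.R i).PosDef
  P_posDef : ∀ i, (S.P i).PosDef
  /-- a terminal feedback `z ↦ -K z` that keeps the terminal set invariant, is admissible for the
  local constraints on it, and decreases the terminal cost by at least the stage cost -/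
  terminal : ∀ i, ∃ K : Matrix (Fin (S.m i)) (Fin (S.n i)) ℝ,
    (∀ z ∈ S.terminalSet i, (S.A i - S.B i * K) *ᵥ z ∈ S.terminalSet i) ∧
    (∀ z ∈ S.terminalSet i, z ∈ S.stateSet i ∧ -(K *ᵥ z) ∈ S.inputSet i) ∧
    ∀ z : Fin (S.n i) → ℝ,
      ((S.A i - S.B i * K) *ᵥ z) ⬝ᵥ (S.P i *ᵥ ((S.A i - S.B i * K) *ᵥ z)) - z ⬝ᵥ (S.P i *ᵥ z)
        ≤ -(z ⬝ᵥ ((S.Q i + Kᵀ * S.R i * K) *ᵥ z))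
  /-- the coupling constraints are inactive at the origin -/
  bbar_pos : ∀ j, 0 < S.bbar j
  /-- the optimal control problem is feasible around the origin -/
  zero_mem_interior : (0 : S.State) ∈ interior S.feasibleSet

/-! ### Condensed problem: the states are eliminated through the dynamics -/

/-- `Â`: block row `k` is `A ^ k`, for `k = 0, …, N`. -/
def Ahat (i : Fin S.M) : Matrix (Fin (S.n i) × Fin (S.N + 1)) (Fin (S.n i)) ℝ :=
  of fun r b => (S.A i ^ (r.2 : ℕ)) r.1 b

/-- `B̂`: block `(k, j)` is `A ^ (k - 1 - j) B` if `j < k`, and `0` otherwise. -/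
def Bhat (i : Fin S.M) :
    Matrix (Fin (S.n i) × Fin (S.N + 1)) (Fin (S.m i) × Fin S.N) ℝ :=
  of fun r s =>
    if (s.2 : ℕ) < (r.2 : ℕ) then (S.A i ^ ((r.2 : ℕ) - 1 - (s.2 : ℕ)) * S.B i) r.1 s.1 else 0

/-- `Ĥ = blkdiag(Q, …, Q, P)`. -/
def Hhat (i : Fin S.M) :
    Matrix (Fin (S.n i) × Fin (S.N + 1)) (Fin (S.n i) × Fin (S.N + 1)) ℝ :=
  blockDiagonal fun k => if k = Fin.last S.N then S.P i else S.Q i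

def H (i : Fin S.M) : Matrix (Fin (S.m i) × Fin S.N) (Fin (S.m i) × Fin S.N) ℝ :=
  (S.Bhat i)ᵀ * S.Hhat i * S.Bhat i + blockDiagonal fun _ => S.R i

def G (i : Fin S.M) : Matrix (Fin (S.m i) × Fin S.N) (Fin (S.n i)) ℝ :=
  (S.Bhat i)ᵀ * S.Hhat i * S.Ahat i

def W (i : Fin S.M) : Matrix (Fin (S.n i)) (Fin (S.n i)) ℝ :=
  (S.Ahat i)ᵀ * S.Hhat i * S.Ahat i

/-- `L̂ = blkdiag(C_x, …, C_x, C_f)`, acting on state trajectories. -/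
def Lhat (i : Fin S.M) : Matrix ((Fin (S.rx i) × Fin S.N) ⊕ Fin (S.rf i))
    (Fin (S.n i) × Fin (S.N + 1)) ℝ :=
  of fun r s => r.elim
    (fun r => if s.2 = r.2.castSucc then S.Cx i r.1 s.1 else 0)
    (fun r => if s.2 = Fin.last S.N then S.Cf i r s.1 else 0)

/-- Local constraints `D x + C u ≤ c` of the condensed problem. -/
def D (i : Fin S.M) : Matrix ((Fin (S.ru i) × Fin S.N) ⊕ ((Fin (S.rx i) × Fin S.N) ⊕ Fin (S.rf i)))
    (Fin (S.n i)) ℝ :=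
  fromRows 0 (S.Lhat i * S.Ahat i)

def C (i : Fin S.M) : Matrix ((Fin (S.ru i) × Fin S.N) ⊕ ((Fin (S.rx i) × Fin S.N) ⊕ Fin (S.rf i)))
    (Fin (S.m i) × Fin S.N) ℝ :=
  fromRows (blockDiagonal fun _ => S.Cu i) (S.Lhat i * S.Bhat i)

def c (i : Fin S.M) :
    (Fin (S.ru i) × Fin S.N) ⊕ ((Fin (S.rx i) × Fin S.N) ⊕ Fin (S.rf i)) → ℝ :=
  Sum.elim (fun r => S.cu i r.1) (Sum.elim (fun r => S.cx i r.1) (S.cf i))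

/-- Coupling constraints `∑ i, (F i x i + E i u i) ≤ b` of the condensed problem; the submatrices
keep the block rows `0, …, N - 1`. -/
def F (i : Fin S.M) : Matrix (Fin S.p × Fin S.N) (Fin (S.n i)) ℝ :=
  (blockDiagonal fun _ => S.Ex i) * (S.Ahat i).submatrix (fun r => (r.1, Fin.castSucc r.2)) id

def E (i : Fin S.M) : Matrix (Fin S.p × Fin S.N) (Fin (S.m i) × Fin S.N) ℝ :=
  (blockDiagonal fun _ => S.Ex i) * (S.Bhat i).submatrix (fun r => (r.1, Fin.castSucc r.2)) id
    + blockDiagonal fun _ => S.Eu i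

def b : S.Dual := fun j => S.bbar j.1

/-- Local cost `f i (u, x) = ½ ‖(u, x)‖²` in the weight `[H G; Gᵀ W]`. -/
noncomputable def f (i : Fin S.M) (u : S.Traj i) (x : Fin (S.n i) → ℝ) : ℝ :=
  1 / 2 * (Sum.elim u x ⬝ᵥ (fromBlocks (S.H i) (S.G i) (S.G i)ᵀ (S.W i) *ᵥ Sum.elim u x))

/-- Local constraint set `Z i (x)` of the condensed problem. -/
def Z (i : Fin S.M) (x : Fin (S.n i) → ℝ) : Set (S.Traj i) :=
  {v | S.D i *ᵥ x + S.C i *ᵥ v ≤ S.c i}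

/-! ### Regularized dual problem -/

/-- Local cost plus indicator function of the local constraints. -/
noncomputable def h (i : Fin S.M) (u : S.Traj i) (x : Fin (S.n i) → ℝ) : EReal :=
  (S.f i u x : EReal) + cvxIndicator (S.Z i x) u

/-- The set `{y | ∑ i, F i x i + y ≤ b}`. -/
def couplingSet (x : S.State) : Set S.Dual := {y | ∑ i, S.F i *ᵥ x i + y ≤ S.b}

/-- Smooth part of the regularized dual cost. -/
noncomputable def dualSmooth (ε : ℝ) (lam : S.Dual) (x : S.State) : EReal :=
  ∑ i, fenchelConj (fun v => S.h i v (x i)) (-((S.E i)ᵀ *ᵥ lam))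
    + ((ε / 2 * S.dualNorm lam ^ 2 : ℝ) : EReal)

/-- Regularized dual cost. -/
noncomputable def dualCost (ε : ℝ) (lam : S.Dual) (x : S.State) : EReal :=
  S.dualSmooth ε lam x + fenchelConj (cvxIndicator (S.couplingSet x)) lam

/-- Regularized dual solution map `S^d_ε`. -/
noncomputable def dualSol (ε : ℝ) (x : S.State) : S.Dual :=
  argminOn univ fun lam => S.dualCost ε lam x

/-- The constant `L = ε + √(∑ i, ‖E i (H i)⁻¹ (E i)ᵀ‖²)`, with spectral norms. -/
noncomputable def lipConst (ε : ℝ) : ℝ :=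
  ε + √(∑ i, ‖toEuclideanCLM (𝕜 := ℝ) (S.E i * (S.H i)⁻¹ * (S.E i)ᵀ)‖ ^ 2)

/-! ### Accelerated dual ascent and the control law -/

/-- Control trajectory update of agent `i`. -/
noncomputable def localSol (i : Fin S.M) (lam : S.Dual) (x : Fin (S.n i) → ℝ) : S.Traj i :=
  argminOn (S.Z i x) fun v => S.f i v x + lam ⬝ᵥ (S.E i *ᵥ v)

/-- Variables of the algorithm: projected iterate, extrapolated iterate, momentum parameter. -/
structure AlgState where
  mu : S.Dual
  lam : S.Dual
  theta : ℝ

/-- One iteration (one communication round) with parameter `x`. -/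
noncomputable def algStep (ε α : ℝ) (x : S.State) (s : S.AlgState) : S.AlgState :=
  let mu' : S.Dual := fun j => max 0 ((s.lam + α •
    (∑ i, (S.F i *ᵥ x i + S.E i *ᵥ S.localSol i s.lam (x i)) - S.b - ε • s.lam)) j)
  let theta' : ℝ := 1 / 2 * (1 + √(1 + 4 * s.theta ^ 2))
  { mu := mu'
    lam := mu' + ((s.theta - 1) / theta') • (mu' - s.mu)
    theta := theta' }

/-- `𝒯^ℓ(lam, x)`: output of `ℓ` iterations started at `lam`. -/
noncomputable def algo (ε α : ℝ) (ℓ : ℕ) (lam : S.Dual) (x : S.State) : S.Dual :=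
  ((S.algStep ε α x)^[ℓ] ⟨lam, lam, 1⟩).lam

/-- Input recovered from the dual variable: stage `0` of the local solutions. -/
noncomputable def q (lam : S.Dual) (x : S.State) : S.Input :=
  fun i a => S.localSol i lam (x i) (a, ⟨0, S.N_pos⟩)

/-- Control law of the regularized problem. -/
noncomputable def kappa (ε : ℝ) (x : S.State) : S.Input := S.q (S.dualSol ε x) x

/-! ### Closed loop in error coordinates -/

/-- `A x + B u + d`. -/
def plant (x : S.State) (u : S.Input) (d : S.State) : S.State :=
  fun i => S.A i *ᵥ x i + S.B i *ᵥ u i + d i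

/-- State increment, the output of the plant subsystem. -/
noncomputable def h₁ (ε : ℝ) (x : S.State) (du : S.Input) (d : S.State) : S.State :=
  S.plant x (S.kappa ε x + du) d - x

/-- Input error, the output of the algorithm subsystem. -/
noncomputable def h₂ (ε : ℝ) (e : S.Dual) (x : S.State) : S.Input :=
  S.q (e + S.dualSol ε x) x - S.q (S.dualSol ε x) x

/-- Error dynamics of the algorithm subsystem. -/
noncomputable def errStep (ε α : ℝ) (ℓ : ℕ) (e : S.Dual) (x dx : S.State) : S.Dual :=
  S.algo ε α ℓ (e + S.dualSol ε x) (x + dx) - S.dualSol ε (x + dx)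

/-- Trajectories of the plant subsystem with input error `du` and disturbance `d`. -/
def IsPlantTrajectory (ε : ℝ) (x : ℕ → S.State) (du : ℕ → S.Input) (d : ℕ → S.State) : Prop :=
  ∀ t, x (t + 1) = S.plant (x t) (S.kappa ε (x t) + du t) (d t)

/-- Trajectories of the plant-algorithm interconnection with disturbance `d`. -/
def IsClosedLoopTrajectory (ε α : ℝ) (ℓ : ℕ) (x : ℕ → S.State) (e : ℕ → S.Dual)
    (d : ℕ → S.State) : Prop :=
  S.IsPlantTrajectory ε x (fun t => S.h₂ ε (e t) (x t)) d ∧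
  ∀ t, e (t + 1) = S.errStep ε α ℓ (e t) (x t) (S.h₁ ε (x t) (S.h₂ ε (e t) (x t)) (d t))

/-- For every regularization parameter `ε ∈ (0, εt]` the plant subsystem is locally input-to-state
stable in `(du, d)`, with `β₁` and the linear gains independent of `ε`, and remains in `Γ_N`. -/
def IsPlantThreshold (εt : ℝ) : Prop :=
  ∃ γ₁ > 0, ∃ σ₁ > 0, ∃ β₁ : ℝ → ℝ → ℝ, ClassKL β₁ ∧ ∀ ε, 0 < ε → ε ≤ εt →
    ∃ ρ > 0, ∀ (x : ℕ → S.State) (du : ℕ → S.Input) (d : ℕ → S.State),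
      S.IsPlantTrajectory ε x du d → S.stateNorm (x 0) ≤ ρ →
      (∀ t, S.inputNorm (du t) ≤ ρ) → (∀ t, S.stateNorm (d t) ≤ ρ) →
      ∀ t, x t ∈ S.feasibleSet ∧
        S.stateNorm (x t) ≤ β₁ (S.stateNorm (x 0)) t
          + γ₁ * (⨆ s, S.inputNorm (du s)) + σ₁ * (⨆ s, S.stateNorm (d s))

/-- The interconnection is locally input-to-state stable with respect to `d`, with state `(x, e)`,
and its plant state remains in `Γ_N`. -/
def IsClosedLoopLISS (ε α : ℝ) (ℓ : ℕ) : Prop :=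
  ∃ ρ > 0, ∃ β : ℝ → ℝ → ℝ, ∃ γ : ℝ → ℝ, ClassKL β ∧ ClassK γ ∧
    ∀ (x : ℕ → S.State) (e : ℕ → S.Dual) (d : ℕ → S.State),
      S.IsClosedLoopTrajectory ε α ℓ x e d →
      S.pairNorm (x 0) (e 0) ≤ ρ → (∀ t, S.stateNorm (d t) ≤ ρ) →
      ∀ t, x t ∈ S.feasibleSet ∧
        S.pairNorm (x t) (e t) ≤ β (S.pairNorm (x 0) (e 0)) t + γ (⨆ s, S.stateNorm (d s))

end DMPC

/-!
Only the behaviour near the origin matters, and there the coupled problem decouples.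

Since `bbar > 0` and the solutions of the local problems are of the size of the state and the dual
variable, the coupling constraints hold strictly for small data. Hence the regularized dual
solution is exactly zero near the origin, for every regularization parameter (`dualSol_eq_zero`),
and a dual ascent step from a small dual variable at a small state is projected to zero. The first
extrapolation of the accelerated scheme has coefficient zero, so every later iterate is zero too
(`algo_eq_zero`): one communication round already removes a small error completely. In
particular neither the threshold on `ε` nor the one on the number of rounds is restrictive locally.

The control law is therefore locally that of `M` independent model predictive controllers. The
terminal set contains the origin, possibly on its boundary (`zero_mem_terminalSet`), so the local
constraints are near the origin those of a polyhedral cone (`exists_add_mem_Z`), and the square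
root `valueRoot` of the optimal local cost is locally subadditive because the root of the cost is
a seminorm. It is comparable with the norm of the state: from below since `Q` is positive definite,
from above since the problem is feasible around the origin (`exists_mem_Z_norm_le`). The usual
shift argument with the terminal feedback (`exists_shift`) makes it contract along the nominal
closed loop, and subadditivity turns input errors and disturbances into additive terms, which
gives a linear dissipation inequality (`exists_lyapunov`) independent of `ε`.

The local solutions are Lipschitz in the dual variable by strong convexity, so adding a multiple
of the norm of the error, which vanishes after one step, gives a Lyapunov function of the
interconnection.
-/

/-! ### Predicted trajectories and the condensed problem -/

namespace DMPC

variable (S : DMPC)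

/-- The predicted state of agent `i` at stage `k` from the initial state `x` under the input
sequence `ν`. Inputs are indexed by `ℕ` so that sequences can be shifted; only the stages below
`k` matter. -/
def predState (i : Fin S.M) (x : Fin (S.n i) → ℝ) (ν : ℕ → Fin (S.m i) → ℝ) :
    ℕ → Fin (S.n i) → ℝ
  | 0 => x
  | k + 1 => S.A i *ᵥ predState i x ν k + S.B i *ᵥ ν k

/-- The condensed input trajectory made of the stages `0, …, N - 1` of an input sequence. -/
def condense (i : Fin S.M) (ν : ℕ → Fin (S.m i) → ℝ) : S.Traj i := fun r => ν r.2 r.1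

lemma exists_condense_eq (i : Fin S.M) (v : S.Traj i) : ∃ ν, S.condense i ν = v :=
  ⟨fun k a => if hk : k < S.N then v (a, ⟨k, hk⟩) else 0, by
    ext ⟨a, k⟩
    simp [condense]⟩

lemma predState_eq_sum (i : Fin S.M) (x : Fin (S.n i) → ℝ) (ν : ℕ → Fin (S.m i) → ℝ) (k : ℕ) :
    S.predState i x ν k = S.A i ^ k *ᵥ x
      + ∑ j ∈ Finset.range k, (S.A i ^ (k - 1 - j) * S.B i) *ᵥ ν j := by
  induction k with
  | zero => simp [predState]
  | succ k ih =>
    rw [predState, ih, Finset.sum_range_succ, mulVec_add, mulVec_mulVec, ← pow_succ',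
      mulVec_sum, add_assoc]
    congr 2
    · refine Finset.sum_congr rfl fun j hj => ?_
      have hj := Finset.mem_range.1 hj
      rw [mulVec_mulVec, ← Matrix.mul_assoc, ← pow_succ']
      congr 3
      omega
    · simp

lemma Ahat_mulVec (i : Fin S.M) (x : Fin (S.n i) → ℝ) (a : Fin (S.n i)) (k : Fin (S.N + 1)) :
    (S.Ahat i *ᵥ x) (a, k) = (S.A i ^ (k : ℕ) *ᵥ x) a := rfl

lemma Bhat_mulVec_condense (i : Fin S.M) (ν : ℕ → Fin (S.m i) → ℝ) (a : Fin (S.n i))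
    (k : Fin (S.N + 1)) :
    (S.Bhat i *ᵥ S.condense i ν) (a, k)
      = ∑ j ∈ Finset.range k, ((S.A i ^ ((k : ℕ) - 1 - j) * S.B i) *ᵥ ν j) a := by
  have h1 : (S.Bhat i *ᵥ S.condense i ν) (a, k) = ∑ j ∈ Finset.range S.N,
      if j < (k : ℕ) then ((S.A i ^ ((k : ℕ) - 1 - j) * S.B i) *ᵥ ν j) a else 0 := by
    rw [Finset.sum_range, mulVec, dotProduct, Fintype.sum_prod_type_right]
    refine Finset.sum_congr rfl fun j _ => ?_
    by_cases hj : (j : ℕ) < (k : ℕ)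
    · simp [Bhat, condense, hj, mulVec, dotProduct]
    · simp [Bhat, hj]
  rw [h1, ← Finset.sum_filter]
  refine Finset.sum_congr ?_ fun _ _ => rfl
  ext j
  have := k.is_lt
  simp only [Finset.mem_filter, Finset.mem_range]
  omega

/-- The condensed matrices reproduce the predicted states. -/
lemma Ahat_add_Bhat (i : Fin S.M) (x : Fin (S.n i) → ℝ) (ν : ℕ → Fin (S.m i) → ℝ)
    (a : Fin (S.n i)) (k : Fin (S.N + 1)) :
    (S.Ahat i *ᵥ x + S.Bhat i *ᵥ S.condense i ν) (a, k) = S.predState i x ν k a := by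
  rw [Pi.add_apply, Ahat_mulVec, Bhat_mulVec_condense, predState_eq_sum, Pi.add_apply,
    Finset.sum_apply]

lemma blockDiagonal_mulVec_apply {m n o : Type*} [Fintype n] [Fintype o] [DecidableEq o]
    (T : o → Matrix m n ℝ) (w : n × o → ℝ) (a : m) (k : o) :
    (blockDiagonal T *ᵥ w) (a, k) = (T k *ᵥ fun b => w (b, k)) a := by
  simp [mulVec, dotProduct, Fintype.sum_prod_type, blockDiagonal_apply]

lemma dotProduct_blockDiagonal {n o : Type*} [Fintype n] [Fintype o] [DecidableEq o]
    (T : o → Matrix n n ℝ) (w : n × o → ℝ) :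
    w ⬝ᵥ (blockDiagonal T *ᵥ w)
      = ∑ k, (fun b => w (b, k)) ⬝ᵥ (T k *ᵥ fun b => w (b, k)) := by
  rw [dotProduct, Fintype.sum_prod_type_right]
  simp only [blockDiagonal_mulVec_apply]
  rfl

lemma Hhat_transpose (hS : S.Assumptions) (i : Fin S.M) : (S.Hhat i)ᵀ = S.Hhat i := by
  rw [Hhat, blockDiagonal_transpose]
  congr 1
  ext1 k
  have hP : (S.P i)ᵀ = S.P i := (hS.P_posDef i).isHermitian
  have hQ : (S.Q i)ᵀ = S.Q i := (hS.Q_posDef i).isHermitian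
  split_ifs <;> assumption

lemma f_eq_Hhat (hS : S.Assumptions) (i : Fin S.M) (x : Fin (S.n i) → ℝ) (v : S.Traj i) :
    S.f i v x = 1 / 2 * ((S.Ahat i *ᵥ x + S.Bhat i *ᵥ v)
        ⬝ᵥ (S.Hhat i *ᵥ (S.Ahat i *ᵥ x + S.Bhat i *ᵥ v))
      + v ⬝ᵥ ((blockDiagonal fun _ : Fin S.N => S.R i) *ᵥ v)) := by
  have hT := S.Hhat_transpose hS i
  rw [f, fromBlocks_mulVec, sumElim_dotProduct_sumElim]
  simp only [Sum.elim_comp_inl, Sum.elim_comp_inr, H, G, W, transpose_mul, transpose_transpose,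
    hT, add_mulVec, ← mulVec_mulVec, mulVec_add, dotProduct_add, add_dotProduct]
  simp only [dotProduct_mulVec _ (S.Bhat i)ᵀ, dotProduct_mulVec _ (S.Ahat i)ᵀ, vecMul_transpose]
  ring

/-- The condensed cost is the cost of the predicted trajectory. -/
lemma f_condense (hS : S.Assumptions) (i : Fin S.M) (x : Fin (S.n i) → ℝ)
    (ν : ℕ → Fin (S.m i) → ℝ) :
    S.f i (S.condense i ν) x = 1 / 2 *
      (S.predState i x ν S.N ⬝ᵥ (S.P i *ᵥ S.predState i x ν S.N)
        + ∑ k ∈ Finset.range S.N, (S.predState i x ν k ⬝ᵥ (S.Q i *ᵥ S.predState i x ν k)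
          + ν k ⬝ᵥ (S.R i *ᵥ ν k))) := by
  rw [f_eq_Hhat S hS, Hhat, dotProduct_blockDiagonal, dotProduct_blockDiagonal]
  simp only [Ahat_add_Bhat]
  rw [Fin.sum_univ_castSucc, Finset.sum_range, Finset.sum_add_distrib]
  simp only [if_true, Fin.val_last, Fin.val_castSucc, (Fin.castSucc_lt_last _).ne, if_false]
  simp only [condense]
  ring

lemma Lhat_mulVec_inl (i : Fin S.M) (w : Fin (S.n i) × Fin (S.N + 1) → ℝ) (r : Fin (S.rx i))
    (k : Fin S.N) :
    (S.Lhat i *ᵥ w) (Sum.inl (r, k)) = (S.Cx i *ᵥ fun a => w (a, k.castSucc)) r := by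
  simp [Lhat, mulVec, dotProduct, Fintype.sum_prod_type]

lemma Lhat_mulVec_inr (i : Fin S.M) (w : Fin (S.n i) × Fin (S.N + 1) → ℝ) (r : Fin (S.rf i)) :
    (S.Lhat i *ᵥ w) (Sum.inr r) = (S.Cf i *ᵥ fun a => w (a, Fin.last S.N)) r := by
  simp [Lhat, mulVec, dotProduct, Fintype.sum_prod_type]

lemma D_add_C (i : Fin S.M) (x : Fin (S.n i) → ℝ) (v : S.Traj i) :
    S.D i *ᵥ x + S.C i *ᵥ v = Sum.elim ((blockDiagonal fun _ : Fin S.N => S.Cu i) *ᵥ v)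
      (S.Lhat i *ᵥ (S.Ahat i *ᵥ x + S.Bhat i *ᵥ v)) := by
  rw [D, C, fromRows_mulVec, fromRows_mulVec, mulVec_add, mulVec_mulVec, mulVec_mulVec]
  ext (r | r) <;> simp

/-- The condensed local constraints are those of the predicted trajectory. -/
lemma condense_mem_Z (i : Fin S.M) (x : Fin (S.n i) → ℝ) (ν : ℕ → Fin (S.m i) → ℝ) :
    S.condense i ν ∈ S.Z i x ↔
      (∀ k < S.N, ν k ∈ S.inputSet i ∧ S.predState i x ν k ∈ S.stateSet i) ∧
        S.predState i x ν S.N ∈ S.terminalSet i := by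
  have h1 : S.condense i ν ∈ S.Z i x ↔
      (∀ (r : Fin (S.ru i)) (k : Fin S.N), (S.Cu i *ᵥ ν k) r ≤ S.cu i r) ∧
      (∀ (r : Fin (S.rx i)) (k : Fin S.N), (S.Cx i *ᵥ S.predState i x ν k) r ≤ S.cx i r) ∧
      ∀ r : Fin (S.rf i), (S.Cf i *ᵥ S.predState i x ν S.N) r ≤ S.cf i r := by
    rw [Z, mem_ofPred_eq, D_add_C, Pi.le_def]
    simp only [Sum.forall, Prod.forall, Sum.elim_inl, Sum.elim_inr, c, Lhat_mulVec_inl,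
      Lhat_mulVec_inr, blockDiagonal_mulVec_apply, Ahat_add_Bhat, Fin.val_castSucc, Fin.val_last]
    rfl
  rw [h1]
  simp only [inputSet, stateSet, terminalSet, mem_ofPred_eq, Pi.le_def]
  constructor
  · rintro ⟨hu, hx, hf⟩
    exact ⟨fun k hk => ⟨fun r => hu r ⟨k, hk⟩, fun r => hx r ⟨k, hk⟩⟩, hf⟩
  · rintro ⟨hux, hf⟩
    exact ⟨fun r k => (hux k k.2).1 r, fun r k => (hux k k.2).2 r, hf⟩

/-- Feasibility of the optimal control problem gives feasibility of each condensed local problem. -/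
lemma Feasible.nonempty_Z {S : DMPC} {x : S.State} {ξ : ∀ i, Fin (S.N + 1) → Fin (S.n i) → ℝ}
    {ν : ∀ i, Fin S.N → Fin (S.m i) → ℝ} (h : S.Feasible x ξ ν) (i : Fin S.M) :
    (S.Z i (x i)).Nonempty := by
  obtain ⟨hdyn, hends, hloc, -⟩ := h
  obtain ⟨ν', hν'⟩ := S.exists_condense_eq i fun r => ν i r.2 r.1
  have hν : ∀ k : Fin S.N, ν' k = ν i k := fun k => funext fun a => congrFun hν' (a, k)
  have hξ : ∀ k : Fin (S.N + 1), S.predState i (x i) ν' k = ξ i k := by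
    intro k
    induction k using Fin.induction with
    | zero => exact (hends i).1.symm
    | succ k ih =>
      rw [hdyn i k, ← ih, ← hν k]
      rfl
  refine ⟨S.condense i ν', (S.condense_mem_Z i _ _).2 ⟨fun k hk => ⟨?_, ?_⟩, ?_⟩⟩
  · have := (hloc i ⟨k, hk⟩).1
    rwa [← hν] at this
  · have := (hloc i ⟨k, hk⟩).2
    rwa [← hξ] at this
  · have := (hends i).2
    rwa [← hξ] at this

end DMPC

/-! ### Quadratic forms and minimizers in finite dimension -/

lemma abs_dotProduct_le {ι : Type*} [Fintype ι] (v w : ι → ℝ) :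
    |v ⬝ᵥ w| ≤ Fintype.card ι * (‖v‖ * ‖w‖) := by
  calc |v ⬝ᵥ w| ≤ ∑ a, |v a * w a| := Finset.abs_sum_le_sum_abs _ _
    _ ≤ ∑ _a : ι, ‖v‖ * ‖w‖ := Finset.sum_le_sum fun a _ => by
        rw [abs_mul]
        exact mul_le_mul (norm_le_pi_norm v a) (norm_le_pi_norm w a) (abs_nonneg _)
          (norm_nonneg _)
    _ = Fintype.card ι * (‖v‖ * ‖w‖) := by simp

lemma exists_norm_mulVec_le {ι κ : Type*} [Fintype ι] [Fintype κ] (T : Matrix κ ι ℝ) :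
    ∃ K, 0 < K ∧ ∀ v, ‖T *ᵥ v‖ ≤ K * ‖v‖ := by
  classical
  refine ⟨‖(LinearMap.toContinuousLinearMap T.mulVecLin)‖ + 1, by positivity, fun v => ?_⟩
  have := (LinearMap.toContinuousLinearMap T.mulVecLin).le_opNorm v
  simp only [LinearMap.coe_toContinuousLinearMap', mulVecLin_apply] at this
  nlinarith [norm_nonneg v]

lemma exists_quadForm_le {ι : Type*} [Fintype ι] (T : Matrix ι ι ℝ) :
    ∃ K, 0 < K ∧ ∀ v, v ⬝ᵥ (T *ᵥ v) ≤ K * ‖v‖ ^ 2 := by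
  obtain ⟨K, hK, hT⟩ := exists_norm_mulVec_le T
  refine ⟨Fintype.card ι * K + 1, by positivity, fun v => ?_⟩
  calc v ⬝ᵥ (T *ᵥ v) ≤ Fintype.card ι * (‖v‖ * ‖T *ᵥ v‖) :=
        (le_abs_self _).trans (abs_dotProduct_le _ _)
    _ ≤ Fintype.card ι * (‖v‖ * (K * ‖v‖)) := by gcongr; exact hT v
    _ ≤ _ := by nlinarith [sq_nonneg ‖v‖]

lemma quadForm_smul {ι : Type*} [Fintype ι] (T : Matrix ι ι ℝ) (t : ℝ) (v : ι → ℝ) :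
    (t • v) ⬝ᵥ (T *ᵥ (t • v)) = t ^ 2 * (v ⬝ᵥ (T *ᵥ v)) := by
  rw [mulVec_smul, dotProduct_smul, smul_dotProduct, smul_eq_mul, smul_eq_mul]
  ring

lemma quadForm_parallelogram {ι : Type*} [Fintype ι] (T : Matrix ι ι ℝ) (v w : ι → ℝ) :
    (v + w) ⬝ᵥ (T *ᵥ (v + w)) + (v - w) ⬝ᵥ (T *ᵥ (v - w))
      = 2 * (v ⬝ᵥ (T *ᵥ v)) + 2 * (w ⬝ᵥ (T *ᵥ w)) := by
  simp only [mulVec_add, mulVec_sub, dotProduct_add, dotProduct_sub, add_dotProduct,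
    sub_dotProduct]
  ring

lemma Matrix.PosDef.quadForm_nonneg {ι : Type*} [Fintype ι] {T : Matrix ι ι ℝ} (hT : T.PosDef)
    (v : ι → ℝ) : 0 ≤ v ⬝ᵥ (T *ᵥ v) := by
  simpa using hT.posSemidef.dotProduct_mulVec_nonneg v

lemma Matrix.PosDef.exists_le_quadForm {ι : Type*} [Fintype ι] {T : Matrix ι ι ℝ}
    (hT : T.PosDef) : ∃ c, 0 < c ∧ ∀ v, c * ‖v‖ ^ 2 ≤ v ⬝ᵥ (T *ᵥ v) := by
  have hcont : Continuous fun v : ι → ℝ => v ⬝ᵥ (T *ᵥ v) := by fun_prop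
  rcases (Metric.sphere (0 : ι → ℝ) 1).eq_empty_or_nonempty with h | h
  · refine ⟨1, one_pos, fun v => ?_⟩
    have hv : v = 0 := by
      by_contra hv
      have : ‖v‖⁻¹ • v ∈ Metric.sphere (0 : ι → ℝ) 1 := by
        simp [norm_smul, norm_ne_zero_iff.2 hv]
      simp [h] at this
    simp [hv]
  · obtain ⟨w, hw, hmin⟩ := (isCompact_sphere (0 : ι → ℝ) 1).exists_isMinOn h hcont.continuousOn
    have hw0 : w ≠ 0 := by
      rintro rfl
      simp at hw
    refine ⟨w ⬝ᵥ (T *ᵥ w), by simpa using hT.dotProduct_mulVec_pos hw0, fun v => ?_⟩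
    by_cases hv : v = 0
    · simp [hv]
    have hv' : ‖v‖ ≠ 0 := norm_ne_zero_iff.2 hv
    have hs : ‖v‖⁻¹ • v ∈ Metric.sphere (0 : ι → ℝ) 1 := by simp [norm_smul, hv']
    have := hmin hs
    simp only [mem_ofPred_eq, quadForm_smul] at this
    calc w ⬝ᵥ (T *ᵥ w) * ‖v‖ ^ 2 ≤ (‖v‖⁻¹ ^ 2 * (v ⬝ᵥ (T *ᵥ v))) * ‖v‖ ^ 2 := by gcongr
      _ = v ⬝ᵥ (T *ᵥ v) := by field_simp

open scoped MatrixOrder in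
/-- A nonnegative symmetric quadratic form is the square of a seminorm. -/
lemma sqrt_quadForm_add_le {ι : Type*} [Fintype ι] {T : Matrix ι ι ℝ} (hT : T.PosSemidef)
    (v w : ι → ℝ) :
    √((v + w) ⬝ᵥ (T *ᵥ (v + w))) ≤ √(v ⬝ᵥ (T *ᵥ v)) + √(w ⬝ᵥ (T *ᵥ w)) := by
  classical
  obtain ⟨L, hL⟩ : ∃ L : Matrix ι ι ℝ, T = Lᴴ * L := by
    refine ⟨CFC.sqrt T, ?_⟩
    rw [(CFC.sqrt_nonneg T).posSemidef.isHermitian.eq, CFC.sqrt_mul_sqrt_self T hT.nonneg]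
  have h (z : ι → ℝ) : √(z ⬝ᵥ (T *ᵥ z)) = ‖WithLp.toLp 2 (L *ᵥ z)‖ := by
    rw [EuclideanSpace.norm_eq, hL, ← mulVec_mulVec, conjTranspose_eq_transpose_of_trivial,
      dotProduct_mulVec, vecMul_transpose]
    simp [dotProduct, sq]
  rw [h, h, h, mulVec_add, WithLp.toLp_add]
  exact norm_add_le _ _

/-- A continuous function with quadratic growth has a minimizer on every nonempty closed set. -/
lemma exists_isMinOn_of_quadratic_growth {ι : Type*} [Fintype ι] {s : Set (ι → ℝ)}
    (hs : IsClosed s) (hne : s.Nonempty) {φ : (ι → ℝ) → ℝ} (hφ : Continuous φ) {c K : ℝ}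
    (hc : 0 < c) (h : ∀ v, c * ‖v‖ ^ 2 - K * ‖v‖ ≤ φ v) : ∃ v ∈ s, IsMinOn φ s v := by
  obtain ⟨v₀, hv₀⟩ := hne
  refine hφ.continuousOn.exists_isMinOn' hs hv₀ ?_
  have h1 : Tendsto (fun t : ℝ => c * t ^ 2 - K * t) atTop atTop := by
    have : (fun t : ℝ => c * t ^ 2 - K * t) = fun t => t * (c * t - K) := by ext; ring
    rw [this]
    exact tendsto_id.atTop_mul_atTop₀
      (tendsto_atTop_add_const_right _ _ (tendsto_id.const_mul_atTop hc))
  have h2 := (h1.comp (tendsto_norm_cocompact_atTop (E := ι → ℝ))).eventually_ge_atTop (φ v₀)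
  exact (h2.filter_mono inf_le_left).mono fun v hv => hv.trans (h v)

namespace DMPC

variable (S : DMPC)

/-! ### The local problems -/

lemma stageCost_le_two_mul_f (hS : S.Assumptions) (i : Fin S.M) (x : Fin (S.n i) → ℝ)
    (ν : ℕ → Fin (S.m i) → ℝ) {k : ℕ} (hk : k < S.N) :
    S.predState i x ν k ⬝ᵥ (S.Q i *ᵥ S.predState i x ν k) + ν k ⬝ᵥ (S.R i *ᵥ ν k)
      ≤ 2 * S.f i (S.condense i ν) x := by
  rw [f_condense S hS]
  have h1 := (hS.P_posDef i).quadForm_nonneg (S.predState i x ν S.N)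
  have h2 := Finset.single_le_sum (f := fun k =>
    S.predState i x ν k ⬝ᵥ (S.Q i *ᵥ S.predState i x ν k) + ν k ⬝ᵥ (S.R i *ᵥ ν k))
    (fun k _ => add_nonneg ((hS.Q_posDef i).quadForm_nonneg _)
      ((hS.R_posDef i).quadForm_nonneg _)) (Finset.mem_range.2 hk)
  linarith

/-- The local cost is coercive in the input trajectory and in the initial state. -/
lemma exists_le_f (hS : S.Assumptions) (i : Fin S.M) :
    ∃ c, 0 < c ∧ ∀ (v : S.Traj i) (x : Fin (S.n i) → ℝ),
      c * ‖v‖ ^ 2 ≤ S.f i v x ∧ c * ‖x‖ ^ 2 ≤ S.f i v x := by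
  obtain ⟨c₁, hc₁, h₁⟩ := (hS.Q_posDef i).exists_le_quadForm
  obtain ⟨c₂, hc₂, h₂⟩ := (hS.R_posDef i).exists_le_quadForm
  refine ⟨min c₁ c₂ / 2, by positivity, fun v x => ?_⟩
  obtain ⟨ν, rfl⟩ := S.exists_condense_eq i v
  have hν (k : ℕ) (hk : k < S.N) : c₂ * ‖ν k‖ ^ 2 ≤ 2 * S.f i (S.condense i ν) x := by
    have := S.stageCost_le_two_mul_f hS i x ν hk
    linarith [h₂ (ν k), (hS.Q_posDef i).quadForm_nonneg (S.predState i x ν k)]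
  have hx : c₁ * ‖x‖ ^ 2 ≤ 2 * S.f i (S.condense i ν) x := by
    have := S.stageCost_le_two_mul_f hS i x ν S.N_pos
    simp only [predState] at this
    linarith [h₁ x, (hS.R_posDef i).quadForm_nonneg (ν 0)]
  have hf : 0 ≤ 2 * S.f i (S.condense i ν) x := le_trans (by positivity) hx
  constructor
  · have hb : ‖S.condense i ν‖ ≤ √(2 * S.f i (S.condense i ν) x / c₂) := by
      refine (pi_norm_le_iff_of_nonneg (Real.sqrt_nonneg _)).2 fun r => ?_
      refine Real.le_sqrt_of_sq_le ?_
      rw [le_div_iff₀ hc₂, mul_comm]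
      refine le_trans ?_ (hν r.2 r.2.2)
      gcongr
      exact norm_le_pi_norm (ν r.2) r.1
    have hb2 : ‖S.condense i ν‖ ^ 2 ≤ 2 * S.f i (S.condense i ν) x / c₂ := by
      calc _ ≤ √(2 * S.f i (S.condense i ν) x / c₂) ^ 2 := by gcongr
        _ = _ := Real.sq_sqrt (by positivity)
    rw [le_div_iff₀ hc₂] at hb2
    nlinarith [min_le_right c₁ c₂, sq_nonneg ‖S.condense i ν‖]
  · nlinarith [min_le_left c₁ c₂, sq_nonneg ‖x‖]

lemma f_nonneg (hS : S.Assumptions) (i : Fin S.M) (v : S.Traj i) (x : Fin (S.n i) → ℝ) :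
    0 ≤ S.f i v x := by
  obtain ⟨c, hc, h⟩ := S.exists_le_f hS i
  exact le_trans (by positivity) (h v x).1

lemma exists_f_le (i : Fin S.M) :
    ∃ K, 0 < K ∧ ∀ (v : S.Traj i) (x : Fin (S.n i) → ℝ), S.f i v x ≤ K * (‖v‖ + ‖x‖) ^ 2 := by
  obtain ⟨K, hK, h⟩ := exists_quadForm_le (fromBlocks (S.H i) (S.G i) (S.G i)ᵀ (S.W i))
  refine ⟨K, hK, fun v x => ?_⟩
  have h1 : ‖(Sum.elim v x : _ → ℝ)‖ ≤ ‖v‖ + ‖x‖ := by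
    refine (pi_norm_le_iff_of_nonneg (by positivity)).2 ?_
    rintro (a | a)
    · exact (norm_le_pi_norm v a).trans (by simp)
    · exact (norm_le_pi_norm x a).trans (by simp)
  have h2 : K * ‖(Sum.elim v x : _ → ℝ)‖ ^ 2 ≤ K * (‖v‖ + ‖x‖) ^ 2 := by gcongr
  rw [f]
  have := h (Sum.elim v x)
  have : 0 ≤ K * (‖v‖ + ‖x‖) ^ 2 := by positivity
  linarith

lemma continuous_f (i : Fin S.M) (x : Fin (S.n i) → ℝ) : Continuous fun v => S.f i v x := by
  have : Continuous fun v : S.Traj i => (Sum.elim v x : _ → ℝ) := by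
    refine continuous_pi ?_
    rintro (a | a)
    · exact continuous_apply a
    · exact continuous_const
  unfold f
  fun_prop

lemma costMatrix_posSemidef (hS : S.Assumptions) (i : Fin S.M) :
    (fromBlocks (S.H i) (S.G i) (S.G i)ᵀ (S.W i)).PosSemidef := by
  have hT := S.Hhat_transpose hS i
  have hR : (S.R i)ᵀ = S.R i := (hS.R_posDef i).isHermitian
  refine .of_dotProduct_mulVec_nonneg (IsHermitian.fromBlocks ?_ ?_ ?_) fun z => ?_
  · simp [IsHermitian, H, hT, hR, blockDiagonal_transpose, Matrix.mul_assoc]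
  · simp
  · simp [IsHermitian, W, hT, Matrix.mul_assoc]
  · have := S.f_nonneg hS i (z ∘ Sum.inl) (z ∘ Sum.inr)
    rw [f, Sum.elim_comp_inl_inr] at this
    simpa using this

lemma sqrt_f_add_le (hS : S.Assumptions) (i : Fin S.M) (v w : S.Traj i)
    (x y : Fin (S.n i) → ℝ) :
    √(S.f i (v + w) (x + y)) ≤ √(S.f i v x) + √(S.f i w y) := by
  have h := sqrt_quadForm_add_le (S.costMatrix_posSemidef hS i) (Sum.elim v x) (Sum.elim w y)
  have hsum : (Sum.elim v x + Sum.elim w y : _ → ℝ) = Sum.elim (v + w) (x + y) := by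
    ext (a | a) <;> rfl
  rw [hsum] at h
  simp only [f, Real.sqrt_mul (show (0 : ℝ) ≤ 1 / 2 by norm_num)]
  rw [← mul_add]
  gcongr

lemma f_midpoint (i : Fin S.M) (v w : S.Traj i) (x : Fin (S.n i) → ℝ) :
    2 * S.f i ((1 / 2 : ℝ) • (v + w)) x + 1 / 2 * S.f i (v - w) 0
      = S.f i v x + S.f i w x := by
  have h := quadForm_parallelogram (fromBlocks (S.H i) (S.G i) (S.G i)ᵀ (S.W i))
    (Sum.elim v x) (Sum.elim w x)
  have h1 : (Sum.elim ((1 / 2 : ℝ) • (v + w)) x : _ → ℝ)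
      = (1 / 2 : ℝ) • (Sum.elim v x + Sum.elim w x) := by
    ext (a | a)
    · rfl
    · simp
      ring
  have h2 : (Sum.elim (v - w) (0 : Fin (S.n i) → ℝ) : _ → ℝ) = Sum.elim v x - Sum.elim w x := by
    ext (a | a)
    · rfl
    · simp
  simp only [f, h1, h2, quadForm_smul]
  linarith

lemma isClosed_Z (i : Fin S.M) (x : Fin (S.n i) → ℝ) : IsClosed (S.Z i x) :=
  isClosed_le (by fun_prop) continuous_const

lemma midpoint_mem_Z {i : Fin S.M} {x : Fin (S.n i) → ℝ} {v w : S.Traj i} (hv : v ∈ S.Z i x)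
    (hw : w ∈ S.Z i x) : (1 / 2 : ℝ) • (v + w) ∈ S.Z i x := by
  simp only [Z, mem_ofPred_eq] at *
  intro r
  have h1 := hv r
  have h2 := hw r
  simp only [mulVec_smul, mulVec_add, Pi.add_apply, Pi.smul_apply, smul_eq_mul] at *
  linarith

/-- The local problems have minimizers, so `localSol` is one of them. -/
lemma localSol_spec (hS : S.Assumptions) {i : Fin S.M} {x : Fin (S.n i) → ℝ}
    (hZ : (S.Z i x).Nonempty) (lam : S.Dual) :
    S.localSol i lam x ∈ S.Z i x ∧ ∀ v ∈ S.Z i x,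
      S.f i (S.localSol i lam x) x + lam ⬝ᵥ (S.E i *ᵥ S.localSol i lam x)
        ≤ S.f i v x + lam ⬝ᵥ (S.E i *ᵥ v) := by
  obtain ⟨c, hc, hf⟩ := S.exists_le_f hS i
  obtain ⟨K, hK, hE⟩ := exists_norm_mulVec_le (S.E i)
  have hex : ∃ v, v ∈ S.Z i x ∧
      IsMinOn (fun v => S.f i v x + lam ⬝ᵥ (S.E i *ᵥ v)) (S.Z i x) v := by
    refine exists_isMinOn_of_quadratic_growth (S.isClosed_Z i x) hZ
      (c := c) (K := Fintype.card (Fin S.p × Fin S.N) * (‖lam‖ * K)) ?_ hc fun v => ?_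
    · exact (S.continuous_f i x).add (by fun_prop)
    · have h1 := (neg_abs_le _).trans' (neg_le_neg (abs_dotProduct_le lam (S.E i *ᵥ v)))
      have h2 : (Fintype.card (Fin S.p × Fin S.N) : ℝ) * (‖lam‖ * ‖S.E i *ᵥ v‖)
          ≤ Fintype.card (Fin S.p × Fin S.N) * (‖lam‖ * (K * ‖v‖)) := by
        gcongr
        exact hE v
      linarith [(hf v x).1]
  exact Classical.epsilon_spec hex

/-- The local solutions are Lipschitz in the dual variable, by strong convexity of the cost. -/
lemma exists_norm_localSol_sub_le (hS : S.Assumptions) (i : Fin S.M) :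
    ∃ K, 0 < K ∧ ∀ x, (S.Z i x).Nonempty → ∀ lam lam' : S.Dual,
      ‖S.localSol i lam x - S.localSol i lam' x‖ ≤ K * ‖lam - lam'‖ := by
  obtain ⟨c, hc, hf⟩ := S.exists_le_f hS i
  obtain ⟨K, hK, hE⟩ := exists_norm_mulVec_le (S.E i)
  set n : ℝ := (Fintype.card (Fin S.p × Fin S.N) : ℝ)
  have hn : 0 ≤ n := Nat.cast_nonneg _
  refine ⟨n * K / c + 1, by positivity, fun x hZ lam lam' => ?_⟩
  obtain ⟨hv, hvmin⟩ := S.localSol_spec hS hZ lam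
  obtain ⟨hw, hwmin⟩ := S.localSol_spec hS hZ lam'
  set v := S.localSol i lam x
  set w := S.localSol i lam' x
  have hm := S.midpoint_mem_Z hv hw
  have h1 := hvmin _ hm
  have h2 := hwmin _ hm
  have h3 := S.f_midpoint i v w x
  have h4 := (hf (v - w) 0).1
  -- comparing both optimal values with the midpoint leaves a term linear in `lam - lam'`
  have h5 : c * ‖v - w‖ ^ 2 ≤ -((lam - lam') ⬝ᵥ (S.E i *ᵥ (v - w))) := by
    simp only [mulVec_smul, mulVec_add, dotProduct_smul, dotProduct_add, smul_eq_mul] at h1 h2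
    simp only [mulVec_sub, dotProduct_sub, sub_dotProduct]
    linarith
  have h6 : -((lam - lam') ⬝ᵥ (S.E i *ᵥ (v - w))) ≤ n * (‖lam - lam'‖ * (K * ‖v - w‖)) := by
    refine (neg_le_abs _).trans ((abs_dotProduct_le _ _).trans ?_)
    gcongr
    exact hE _
  have h7 : c * ‖v - w‖ ≤ n * K * ‖lam - lam'‖ := by
    rcases (norm_nonneg (v - w)).eq_or_lt with h0 | h0
    · rw [← h0]
      simp only [mul_zero]
      positivity
    · refine le_of_mul_le_mul_right ?_ h0
      linarith
  have h8 : ‖v - w‖ ≤ n * K / c * ‖lam - lam'‖ := by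
    rw [div_mul_eq_mul_div, le_div_iff₀ hc]
    linarith
  linarith [norm_nonneg (lam - lam')]

end DMPC

namespace DMPC

variable (S : DMPC)

/-! ### The decoupled value function near the origin -/

lemma isClosed_terminalSet (i : Fin S.M) : IsClosed (S.terminalSet i) :=
  isClosed_le (by fun_prop) continuous_const

/-- The terminal set contains the origin: it is closed and invariant under the terminal feedback,
which strictly decreases the terminal cost, so the terminal cost can only be minimal on it at the
origin. -/
lemma zero_mem_terminalSet (hS : S.Assumptions) (i : Fin S.M) :
    (0 : Fin (S.n i) → ℝ) ∈ S.terminalSet i := by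
  obtain ⟨ξ, ν, hfeas⟩ := interior_subset hS.zero_mem_interior
  obtain ⟨c, hc, hP⟩ := (hS.P_posDef i).exists_le_quadForm
  obtain ⟨z, hz, hmin⟩ := exists_isMinOn_of_quadratic_growth (S.isClosed_terminalSet i)
    ⟨_, (hfeas.2.1 i).2⟩ (φ := fun z => z ⬝ᵥ (S.P i *ᵥ z)) (K := 0) (by fun_prop) hc
    fun v => by simpa using hP v
  obtain ⟨K, hinv, -, hdec⟩ := hS.terminal i
  obtain ⟨q, hq, hQ⟩ := (hS.Q_posDef i).exists_le_quadForm
  have h1 : z ⬝ᵥ (S.P i *ᵥ z) ≤ _ := hmin (hinv z hz)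
  have h2 := hdec z
  have h3 : 0 ≤ z ⬝ᵥ ((Kᵀ * S.R i * K) *ᵥ z) := by
    rw [← mulVec_mulVec, ← mulVec_mulVec, dotProduct_mulVec, vecMul_transpose]
    exact (hS.R_posDef i).quadForm_nonneg _
  rw [add_mulVec, dotProduct_add] at h2
  have h4 : q * ‖z‖ ^ 2 ≤ 0 := (hQ z).trans (by linarith)
  have h5 : z = 0 := by
    by_contra h
    have : 0 < q * ‖z‖ ^ 2 := by positivity
    linarith
  rwa [← h5]

lemma predState_zero (i : Fin S.M) (k : ℕ) : S.predState i 0 (fun _ => 0) k = 0 := by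
  rw [predState_eq_sum]
  simp

lemma zero_mem_Z (hS : S.Assumptions) (i : Fin S.M) : (0 : S.Traj i) ∈ S.Z i 0 := by
  have h := (S.condense_mem_Z i 0 fun _ => 0).2
    ⟨fun k _ => ⟨interior_subset (hS.zero_mem_inputSet i), ?_⟩, ?_⟩
  · exact h
  · rw [predState_zero]
    exact interior_subset (hS.zero_mem_stateSet i)
  · rw [predState_zero]
    exact S.zero_mem_terminalSet hS i

lemma c_nonneg (hS : S.Assumptions) (i : Fin S.M) : 0 ≤ S.c i := by
  have : S.D i *ᵥ 0 + S.C i *ᵥ 0 ≤ S.c i := S.zero_mem_Z hS i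
  simpa using this

lemma exists_feasible_nhds (hS : S.Assumptions) :
    ∃ r, 0 < r ∧ ∀ x : S.State, ‖x‖ ≤ r → x ∈ S.feasibleSet := by
  obtain ⟨r, hr, h⟩ := Metric.nhds_basis_closedBall.mem_iff.1
    (mem_interior_iff_mem_nhds.1 hS.zero_mem_interior)
  exact ⟨r, hr, fun x hx => h (by simpa using hx)⟩

lemma exists_nonempty_Z (hS : S.Assumptions) (i : Fin S.M) :
    ∃ r, 0 < r ∧ ∀ x, ‖x‖ ≤ r → (S.Z i x).Nonempty := by
  obtain ⟨r, hr, h⟩ := S.exists_feasible_nhds hS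
  refine ⟨r, hr, fun x hx => ?_⟩
  obtain ⟨ξ, ν, hf⟩ := h (Pi.single i x) ((pi_norm_le_iff_of_nonneg hr.le).2 fun j => by
    by_cases hj : j = i
    · subst hj
      simpa using hx
    · simpa [Pi.single_eq_of_ne hj] using hr.le)
  simpa using hf.nonempty_Z i

/-- Small states admit input trajectories of proportional size: `x` is a combination, with
weights `|x a| / r` of sum at most one, of finitely many feasible states `± r` times a unit
vector. -/
lemma exists_mem_Z_norm_le (hS : S.Assumptions) (i : Fin S.M) :
    ∃ C r, 0 < C ∧ 0 < r ∧ ∀ x, ‖x‖ ≤ r → ∃ v ∈ S.Z i x, ‖v‖ ≤ C * ‖x‖ := by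
  obtain ⟨r, hr, hne⟩ := S.exists_nonempty_Z hS i
  have hpt (a : Fin (S.n i)) (s : SignType) :
      ‖(Pi.single a (r * (s : ℝ)) : Fin (S.n i) → ℝ)‖ ≤ r := by
    rw [Pi.norm_single, norm_mul, Real.norm_of_nonneg hr.le]
    cases s <;> simp [hr.le]
  choose w hw using fun a s => hne _ (hpt a s)
  set K : ℝ := ∑ a, ∑ s, ‖w a s‖
  have hK : 0 ≤ K := by positivity
  have hwK (a : Fin (S.n i)) (s : SignType) : ‖w a s‖ ≤ K :=
    (Finset.single_le_sum (f := fun s => ‖w a s‖) (fun _ _ => norm_nonneg _)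
      (Finset.mem_univ s)).trans
    (Finset.single_le_sum (f := fun a => ∑ s, ‖w a s‖)
      (fun _ _ => Finset.sum_nonneg fun _ _ => norm_nonneg _) (Finset.mem_univ a))
  refine ⟨S.n i * (K / r) + 1, r / (S.n i + 1), by positivity, by positivity, fun x hx => ?_⟩
  have hxa (a : Fin (S.n i)) : |x a| ≤ ‖x‖ := norm_le_pi_norm x a
  have hsum : ∑ a, |x a| / r ≤ 1 := by
    calc ∑ a, |x a| / r ≤ ∑ _a : Fin (S.n i), (r / (S.n i + 1)) / r := by
          gcongr with a
          exact (hxa a).trans hx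
      _ = S.n i / (S.n i + 1) := by
          simp
          field_simp
      _ ≤ 1 := by
          rw [div_le_one (by positivity)]
          linarith
  have hx_eq : x = ∑ a, (|x a| / r) • (Pi.single a (r * (SignType.sign (x a) : ℝ))) := by
    ext b
    rw [Finset.sum_apply, Finset.sum_eq_single b]
    · simp only [Pi.smul_apply, Pi.single_eq_same, smul_eq_mul]
      rw [← mul_assoc, div_mul_cancel₀ _ hr.ne']
      exact (abs_mul_sign (x b)).symm
    · intro a _ hab
      simp [Pi.single_eq_of_ne hab.symm]
    · simp
  refine ⟨∑ a, (|x a| / r) • w a (SignType.sign (x a)), ?_, ?_⟩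
  · intro j
    have hcj : 0 ≤ S.c i j := S.c_nonneg hS i j
    have hDx : S.D i *ᵥ x = S.D i *ᵥ ∑ a, (|x a| / r) •
        Pi.single a (r * (SignType.sign (x a) : ℝ)) := congrArg _ hx_eq
    rw [hDx, mulVec_sum, mulVec_sum, ← Finset.sum_add_distrib, Finset.sum_apply]
    calc _ = ∑ a, (|x a| / r) * ((S.D i *ᵥ Pi.single a (r * (SignType.sign (x a) : ℝ))
            + S.C i *ᵥ w a (SignType.sign (x a))) j) := by
          refine Finset.sum_congr rfl fun a _ => ?_
          rw [mulVec_smul, mulVec_smul, ← smul_add, Pi.smul_apply, smul_eq_mul]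
      _ ≤ ∑ a, (|x a| / r) * S.c i j := by
          gcongr with a
          exact hw a (SignType.sign (x a)) j
      _ ≤ S.c i j := by
          rw [← Finset.sum_mul]
          nlinarith
  · calc _ ≤ ∑ a, ‖(|x a| / r) • w a (SignType.sign (x a))‖ := norm_sum_le _ _
      _ ≤ ∑ _a : Fin (S.n i), (‖x‖ / r) * K := by
          gcongr with a
          rw [norm_smul, Real.norm_of_nonneg (by positivity)]
          exact mul_le_mul (by gcongr; exact hxa a) (hwK _ _) (norm_nonneg _) (by positivity)
      _ = S.n i * (K / r) * ‖x‖ := by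
          simp
          ring
      _ ≤ _ := by nlinarith [norm_nonneg x]

/-- Near the origin the graph of `Z` is closed under addition: the constraints that are active at
the origin are homogeneous, and the others hold with a margin. -/
lemma exists_add_mem_Z (hS : S.Assumptions) (i : Fin S.M) :
    ∃ r, 0 < r ∧ ∀ x y v w, ‖x‖ ≤ r → ‖y‖ ≤ r → ‖v‖ ≤ r → ‖w‖ ≤ r →
      v ∈ S.Z i x → w ∈ S.Z i y → v + w ∈ S.Z i (x + y) := by
  have hev : ∀ᶠ z : (Fin (S.n i) → ℝ) × S.Traj i in 𝓝 0,
      ∀ j, 0 < S.c i j → (S.D i *ᵥ z.1 + S.C i *ᵥ z.2) j < S.c i j / 2 := by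
    refine eventually_all.2 fun j => ?_
    by_cases hj : 0 < S.c i j
    · have hcont : Continuous fun z : (Fin (S.n i) → ℝ) × S.Traj i =>
          (S.D i *ᵥ z.1 + S.C i *ᵥ z.2) j := by fun_prop
      filter_upwards [hcont.continuousAt.eventually_lt_const
        (show (S.D i *ᵥ (0 : _ × S.Traj i).1 + S.C i *ᵥ (0 : _ × S.Traj i).2) j < S.c i j / 2 by
          simpa using hj)] with z hz _ using hz
    · exact .of_forall fun _ h => absurd h hj
  obtain ⟨r, hr, h⟩ := Metric.nhds_basis_closedBall.eventually_iff.1 hev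
  refine ⟨r, hr, fun x y v w hx hy hv hw hvZ hwZ j => ?_⟩
  have h1 := @h (x, v) (by simpa [Prod.norm_def] using ⟨hx, hv⟩) j
  have h2 := @h (y, w) (by simpa [Prod.norm_def] using ⟨hy, hw⟩) j
  have h3 := hvZ j
  have h4 := hwZ j
  have hc : 0 ≤ S.c i j := S.c_nonneg hS i j
  simp only [mulVec_add, Pi.add_apply] at *
  rcases hc.eq_or_lt with h0 | h0
  · linarith
  · linarith [h1 h0, h2 h0]

/-- The square root of the optimal local cost when the coupling is ignored, i.e. at dual variable
zero. Near the origin it is a possibly asymmetric norm. -/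
noncomputable def valueRoot (i : Fin S.M) (x : Fin (S.n i) → ℝ) : ℝ :=
  √(S.f i (S.localSol i 0 x) x)

lemma valueRoot_nonneg (i : Fin S.M) (x : Fin (S.n i) → ℝ) : 0 ≤ S.valueRoot i x :=
  Real.sqrt_nonneg _

lemma valueRoot_le (hS : S.Assumptions) {i : Fin S.M} {x : Fin (S.n i) → ℝ} {v : S.Traj i}
    (hv : v ∈ S.Z i x) : S.valueRoot i x ≤ √(S.f i v x) := by
  have := (S.localSol_spec hS ⟨v, hv⟩ 0).2 v hv
  simp only [zero_dotProduct, add_zero] at this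
  exact Real.sqrt_le_sqrt this

lemma exists_norm_le_valueRoot (hS : S.Assumptions) (i : Fin S.M) :
    ∃ K, 0 < K ∧ ∀ x, ‖x‖ ≤ K * S.valueRoot i x ∧
      ‖S.localSol i 0 x‖ ≤ K * S.valueRoot i x := by
  obtain ⟨c, hc, h⟩ := S.exists_le_f hS i
  have key (t F : ℝ) (hF : c * t ^ 2 ≤ F) : t ≤ (√c)⁻¹ * √F := by
    rw [← div_eq_inv_mul, ← Real.sqrt_div' _ hc.le]
    refine Real.le_sqrt_of_sq_le ?_
    rw [le_div_iff₀ hc]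
    linarith
  exact ⟨(√c)⁻¹, by positivity, fun x => ⟨key _ _ (h _ x).2, key _ _ (h _ x).1⟩⟩

lemma exists_valueRoot_le (hS : S.Assumptions) (i : Fin S.M) :
    ∃ K r, 0 < K ∧ 0 < r ∧ ∀ x, ‖x‖ ≤ r → S.valueRoot i x ≤ K * ‖x‖ := by
  obtain ⟨C, r, hC, hr, hv⟩ := S.exists_mem_Z_norm_le hS i
  obtain ⟨K, hK, hf⟩ := S.exists_f_le i
  refine ⟨√K * (C + 1), r, by positivity, hr, fun x hx => ?_⟩
  obtain ⟨v, hvZ, hvC⟩ := hv x hx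
  refine (S.valueRoot_le hS hvZ).trans (Real.sqrt_le_iff.2 ⟨by positivity, ?_⟩)
  calc S.f i v x ≤ K * (‖v‖ + ‖x‖) ^ 2 := hf v x
    _ ≤ K * (C * ‖x‖ + ‖x‖) ^ 2 := by gcongr
    _ = (√K) ^ 2 * ((C + 1) * ‖x‖) ^ 2 := by
        rw [Real.sq_sqrt hK.le]
        ring
    _ = _ := by ring

lemma exists_norm_localSol_zero_le (hS : S.Assumptions) (i : Fin S.M) :
    ∃ K r, 0 < K ∧ 0 < r ∧ ∀ x, ‖x‖ ≤ r → ‖S.localSol i 0 x‖ ≤ K * ‖x‖ := by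
  obtain ⟨K, hK, h⟩ := S.exists_norm_le_valueRoot hS i
  obtain ⟨K', r, hK', hr, h'⟩ := S.exists_valueRoot_le hS i
  refine ⟨K * K', r, by positivity, hr, fun x hx => (h x).2.trans ?_⟩
  rw [mul_assoc]
  gcongr
  exact h' x hx

/-- Adding the optimal input trajectories of two small states gives a feasible trajectory of their
sum. -/
lemma exists_valueRoot_add_le (hS : S.Assumptions) (i : Fin S.M) :
    ∃ r, 0 < r ∧ ∀ x y, ‖x‖ ≤ r → ‖y‖ ≤ r →
      S.valueRoot i (x + y) ≤ S.valueRoot i x + S.valueRoot i y := by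
  obtain ⟨r₁, hr₁, hne⟩ := S.exists_nonempty_Z hS i
  obtain ⟨r₂, hr₂, hadd⟩ := S.exists_add_mem_Z hS i
  obtain ⟨K, r₃, hK, hr₃, hu⟩ := S.exists_norm_localSol_zero_le hS i
  refine ⟨min (min r₁ r₂) (min r₃ (r₂ / K)), by positivity, fun x y hx hy => ?_⟩
  simp only [le_min_iff, le_div_iff₀ hK] at hx hy
  obtain ⟨⟨hx1, hx2⟩, hx3, hx4⟩ := hx
  obtain ⟨⟨hy1, hy2⟩, hy3, hy4⟩ := hy
  have hmem := hadd x y _ _ hx2 hy2 ((hu x hx3).trans (by linarith))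
    ((hu y hy3).trans (by linarith)) (S.localSol_spec hS (hne x hx1) 0).1
    (S.localSol_spec hS (hne y hy1) 0).1
  exact (S.valueRoot_le hS hmem).trans (S.sqrt_f_add_le hS i _ _ x y)

/-- Dropping the first stage of a feasible trajectory and appending the terminal feedback is
feasible for the successor state and saves at least the first stage cost. -/
lemma exists_shift (hS : S.Assumptions) {i : Fin S.M} {x : Fin (S.n i) → ℝ} {v : S.Traj i}
    (hv : v ∈ S.Z i x) :
    ∃ w ∈ S.Z i (S.A i *ᵥ x + S.B i *ᵥ fun a => v (a, ⟨0, S.N_pos⟩)),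
      S.f i w (S.A i *ᵥ x + S.B i *ᵥ fun a => v (a, ⟨0, S.N_pos⟩))
        ≤ S.f i v x - 1 / 2 * (x ⬝ᵥ (S.Q i *ᵥ x)) := by
  obtain ⟨K, hinv, hadm, hdec⟩ := hS.terminal i
  obtain ⟨ν, rfl⟩ := S.exists_condense_eq i v
  obtain ⟨n, hn⟩ : ∃ n, S.N = n + 1 := ⟨S.N - 1, by have := S.N_pos; omega⟩
  obtain ⟨hloc, hterm⟩ := (S.condense_mem_Z i x ν).1 hv
  set ζ := S.predState i x ν S.N
  set ν' : ℕ → Fin (S.m i) → ℝ := fun k => if k < n then ν (k + 1) else -(K *ᵥ ζ)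
  have hx' : (S.A i *ᵥ x + S.B i *ᵥ fun a => S.condense i ν (a, ⟨0, S.N_pos⟩))
      = S.predState i x ν 1 := rfl
  rw [hx']
  have hν'lt {k : ℕ} (hk : k < n) : ν' k = ν (k + 1) := if_pos hk
  have hν'n : ν' n = -(K *ᵥ ζ) := if_neg (lt_irrefl n)
  have hpred (k : ℕ) (hk : k ≤ n) :
      S.predState i (S.predState i x ν 1) ν' k = S.predState i x ν (k + 1) := by
    induction k with
    | zero => rfl
    | succ k ih => rw [predState, ih (by omega), hν'lt (by omega), predState.eq_2 S i x ν (k + 1)]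
  have hζ : S.predState i x ν (n + 1) = ζ := by rw [← hn]
  have hlast : S.predState i (S.predState i x ν 1) ν' (n + 1) = (S.A i - S.B i * K) *ᵥ ζ := by
    rw [predState, hpred n le_rfl, hν'n, hζ, sub_mulVec, mulVec_neg, mulVec_mulVec,
      sub_eq_add_neg]
  refine ⟨S.condense i ν', (S.condense_mem_Z i _ _).2 ⟨fun k hk => ?_, ?_⟩, ?_⟩
  · rw [hpred k (by omega)]
    rcases (show k < n ∨ k = n by omega) with h | rfl
    · rw [hν'lt h]
      exact hloc (k + 1) (by omega)
    · rw [hν'n, hζ]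
      exact ⟨(hadm ζ hterm).2, (hadm ζ hterm).1⟩
  · rw [hn, hlast]
    exact hinv ζ hterm
  · have hd := hdec ζ
    have h1 : ζ ⬝ᵥ ((S.Q i + Kᵀ * S.R i * K) *ᵥ ζ)
        = ζ ⬝ᵥ (S.Q i *ᵥ ζ) + (-(K *ᵥ ζ)) ⬝ᵥ (S.R i *ᵥ (-(K *ᵥ ζ))) := by
      rw [add_mulVec, dotProduct_add, ← mulVec_mulVec, ← mulVec_mulVec, dotProduct_mulVec _ Kᵀ,
        vecMul_transpose, mulVec_neg, neg_dotProduct_neg]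
    rw [h1] at hd
    rw [f_condense S hS, f_condense S hS, hn, hlast, Finset.sum_range_succ,
      Finset.sum_range_succ' (n := n), hpred n le_rfl, hν'n, hζ]
    rw [Finset.sum_congr rfl (g := fun k => S.predState i x ν (k + 1) ⬝ᵥ
      (S.Q i *ᵥ S.predState i x ν (k + 1)) + ν (k + 1) ⬝ᵥ (S.R i *ᵥ ν (k + 1)))
      fun k hk => by
        have hk := Finset.mem_range.1 hk
        rw [hpred k hk.le, hν'lt hk]]
    have hR := (hS.R_posDef i).quadForm_nonneg (ν 0)
    simp only [predState.eq_1]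
    linarith

/-- The decoupled optimal feedback contracts the root of the value function. -/
lemma exists_valueRoot_contract (hS : S.Assumptions) (i : Fin S.M) :
    ∃ K₀ r, 0 < r ∧ ∀ K, K₀ ≤ K → ∀ x, ‖x‖ ≤ r →
      S.valueRoot i (S.A i *ᵥ x + S.B i *ᵥ fun a => S.localSol i 0 x (a, ⟨0, S.N_pos⟩))
        ≤ (1 - 1 / K) * S.valueRoot i x := by
  obtain ⟨r₁, hr₁, hne⟩ := S.exists_nonempty_Z hS i
  obtain ⟨C, r₂, hC, hr₂, hV⟩ := S.exists_valueRoot_le hS i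
  obtain ⟨c, hc, hQ⟩ := (hS.Q_posDef i).exists_le_quadForm
  refine ⟨max 1 (4 * C ^ 2 / c), min r₁ r₂, by positivity, fun K hK x hx => ?_⟩
  have hx1 := hx.trans (min_le_left _ _)
  have hx2 := hx.trans (min_le_right _ _)
  have hK1 : 1 ≤ K := (le_max_left _ _).trans hK
  have hK0 : 0 < K := by linarith
  have hK2 : 4 * C ^ 2 ≤ K * c := by
    rw [← div_le_iff₀ hc]
    exact (le_max_right _ _).trans hK
  obtain ⟨w, hw, hwf⟩ := S.exists_shift hS (S.localSol_spec hS (hne x hx1) 0).1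
  have hfV : S.f i (S.localSol i 0 x) x = S.valueRoot i x ^ 2 :=
    (Real.sq_sqrt (S.f_nonneg hS _ _ _)).symm
  have h0 := S.valueRoot_nonneg i x
  have h1 : S.valueRoot i x ^ 2 ≤ C ^ 2 * ‖x‖ ^ 2 := by
    rw [← mul_pow]
    gcongr
    exact hV x hx2
  -- the saved stage cost is at least the fraction `2 / K` of the optimal cost
  have h2 : 2 / K * S.valueRoot i x ^ 2 ≤ 1 / 2 * (x ⬝ᵥ (S.Q i *ᵥ x)) := by
    rw [div_mul_eq_mul_div, div_le_iff₀ hK0]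
    nlinarith [hQ x, sq_nonneg ‖x‖]
  have hK3 : 1 / K ≤ 1 := by
    rw [div_le_one hK0]
    exact hK1
  refine (S.valueRoot_le hS hw).trans (Real.sqrt_le_iff.2
    ⟨mul_nonneg (by linarith) h0, hwf.trans ?_⟩)
  rw [hfV]
  have h3 : 2 / K = 2 * (1 / K) := by ring
  rw [h3] at h2
  nlinarith [mul_nonneg (sq_nonneg (1 / K)) (sq_nonneg (S.valueRoot i x))]

end DMPC

lemma le_fenchelConj {ι : Type*} [Fintype ι] (h : (ι → ℝ) → EReal) (μ v : ι → ℝ) :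
    ((μ ⬝ᵥ v : ℝ) : EReal) - h v ≤ fenchelConj h μ :=
  le_iSup (fun v : ι → ℝ => ((μ ⬝ᵥ v : ℝ) : EReal) - h v) v

lemma coe_sum_ereal {ι : Type*} (s : Finset ι) (f : ι → ℝ) :
    ((∑ i ∈ s, f i : ℝ) : EReal) = ∑ i ∈ s, (f i : EReal) :=
  map_sum (⟨⟨Real.toEReal, EReal.coe_zero⟩, EReal.coe_add⟩ : ℝ →+ EReal) f s

namespace DMPC

variable (S : DMPC)

/-! ### The regularized dual problem and the algorithm when the coupling is inactive -/

lemma h_eq_of_mem {i : Fin S.M} {x : Fin (S.n i) → ℝ} {v : S.Traj i} (hv : v ∈ S.Z i x) :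
    S.h i v x = (S.f i v x : EReal) := by
  simp [h, cvxIndicator, hv]

lemma h_eq_top {i : Fin S.M} {x : Fin (S.n i) → ℝ} {v : S.Traj i} (hv : v ∉ S.Z i x) :
    S.h i v x = ⊤ := by
  simp [h, cvxIndicator, hv]

/-- If the decoupled solutions satisfy the coupling constraints, then the dual variable zero is
optimal: they are themselves the test points in the conjugates that show that the dual cost at
`lam` exceeds the one at zero by at least the regularization term. -/
lemma dualSol_eq_zero (hS : S.Assumptions) {ε : ℝ} (hε : 0 < ε) {x : S.State}
    (hZ : ∀ i, (S.Z i (x i)).Nonempty)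
    (hx : ∑ i, S.F i *ᵥ x i + ∑ i, S.E i *ᵥ S.localSol i 0 (x i) ≤ S.b) :
    S.dualSol ε x = 0 := by
  set u : ∀ i, S.Traj i := fun i => S.localSol i 0 (x i)
  have hu (i) : u i ∈ S.Z i (x i) := (S.localSol_spec hS (hZ i) 0).1
  have hmin (i) (v) (hv : v ∈ S.Z i (x i)) : S.f i (u i) (x i) ≤ S.f i v (x i) := by
    simpa using (S.localSol_spec hS (hZ i) 0).2 v hv
  have hzero : S.dualCost ε 0 x ≤ ((∑ i, -S.f i (u i) (x i) : ℝ) : EReal) := by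
    have h1 (i) : fenchelConj (fun v => S.h i v (x i)) (-((S.E i)ᵀ *ᵥ 0))
        ≤ ((-S.f i (u i) (x i) : ℝ) : EReal) := by
      refine iSup_le fun v => ?_
      by_cases hv : v ∈ S.Z i (x i)
      · beta_reduce
        rw [S.h_eq_of_mem hv, ← EReal.coe_sub, EReal.coe_le_coe_iff]
        simpa using hmin i v hv
      · beta_reduce
        rw [S.h_eq_top hv]
        simp
    have h2 : fenchelConj (cvxIndicator (S.couplingSet x)) 0 ≤ 0 := by
      refine iSup_le fun v => ?_
      by_cases hv : v ∈ S.couplingSet x <;> simp [cvxIndicator, hv]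
    have h3 : S.dualNorm 0 = 0 := by simp [dualNorm]
    rw [dualCost, dualSmooth, h3, coe_sum_ereal]
    refine (add_le_add (add_le_add (Finset.sum_le_sum fun i _ => h1 i) le_rfl) h2).trans ?_
    simp
  have hlower (lam : S.Dual) :
      ((∑ i, -S.f i (u i) (x i) + ε / 2 * S.dualNorm lam ^ 2 : ℝ) : EReal)
        ≤ S.dualCost ε lam x := by
    have h1 (i) : ((-((S.E i)ᵀ *ᵥ lam) ⬝ᵥ u i - S.f i (u i) (x i) : ℝ) : EReal)
        ≤ fenchelConj (fun v => S.h i v (x i)) (-((S.E i)ᵀ *ᵥ lam)) := by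
      refine le_trans (le_of_eq ?_) (le_fenchelConj _ _ (u i))
      rw [S.h_eq_of_mem (hu i), ← EReal.coe_sub]
    have hy : (∑ i, S.E i *ᵥ u i) ∈ S.couplingSet x := hx
    have h2 : ((lam ⬝ᵥ ∑ i, S.E i *ᵥ u i : ℝ) : EReal)
        ≤ fenchelConj (cvxIndicator (S.couplingSet x)) lam := by
      refine le_trans (le_of_eq ?_) (le_fenchelConj _ _ (∑ i, S.E i *ᵥ u i))
      simp [cvxIndicator, hy]
    rw [dualCost, dualSmooth]
    refine le_trans (le_of_eq ?_)
      (add_le_add (add_le_add (Finset.sum_le_sum fun i _ => h1 i) le_rfl) h2)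
    rw [← coe_sum_ereal, ← EReal.coe_add, ← EReal.coe_add, EReal.coe_eq_coe_iff,
      dotProduct_sum, Finset.sum_sub_distrib, Finset.sum_neg_distrib]
    have h4 (i) : -((S.E i)ᵀ *ᵥ lam) ⬝ᵥ u i = -(lam ⬝ᵥ (S.E i *ᵥ u i)) := by
      rw [neg_dotProduct, mulVec_transpose, dotProduct_mulVec]
    simp only [h4, Finset.sum_neg_distrib]
    ring
  have hopt : (0 : S.Dual) ∈ univ ∧ IsMinOn (fun lam => S.dualCost ε lam x) univ 0 := by
    refine ⟨mem_univ _, fun lam _ => hzero.trans (le_trans ?_ (hlower lam))⟩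
    rw [EReal.coe_le_coe_iff]
    have : 0 ≤ ε / 2 * S.dualNorm lam ^ 2 := by positivity
    linarith
  have hsol : S.dualSol ε x ∈ univ ∧
      IsMinOn (fun lam => S.dualCost ε lam x) univ (S.dualSol ε x) :=
    Classical.epsilon_spec (p := fun v => v ∈ univ ∧
      IsMinOn (fun lam => S.dualCost ε lam x) univ v) ⟨0, hopt⟩
  have hle := (hlower (S.dualSol ε x)).trans ((hsol.2 (mem_univ 0)).trans hzero)
  rw [EReal.coe_le_coe_iff] at hle
  have hnorm : S.dualNorm (S.dualSol ε x) ^ 2 ≤ 0 := by nlinarith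
  have hsq : 0 ≤ ∑ j, S.dualSol ε x j ^ 2 := by positivity
  rw [dualNorm, Real.sq_sqrt hsq] at hnorm
  ext j
  have := Finset.single_le_sum (f := fun j => S.dualSol ε x j ^ 2) (fun _ _ => sq_nonneg _)
    (Finset.mem_univ j)
  exact pow_eq_zero_iff two_ne_zero |>.1 (le_antisymm (this.trans hnorm) (sq_nonneg _))

/-- If the dual ascent steps from `lam` and from zero are both projected to zero, the algorithm
returns zero after any positive number of rounds: the first extrapolation has coefficient zero. -/
lemma algo_eq_zero {ε α : ℝ} {x : S.State} {lam : S.Dual}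
    (hlam : lam + α • (∑ i, (S.F i *ᵥ x i + S.E i *ᵥ S.localSol i lam (x i)) - S.b - ε • lam) ≤ 0)
    (h0 : α • (∑ i, (S.F i *ᵥ x i + S.E i *ᵥ S.localSol i 0 (x i)) - S.b) ≤ 0)
    {ℓ : ℕ} (hℓ : 0 < ℓ) : S.algo ε α ℓ lam x = 0 := by
  obtain ⟨k, rfl⟩ : ∃ k, ℓ = k + 1 := ⟨ℓ - 1, by omega⟩
  have h1 : (S.algStep ε α x ⟨lam, lam, 1⟩).mu = 0 := funext fun j => max_eq_left (hlam j)
  have h2 : (S.algStep ε α x ⟨lam, lam, 1⟩).lam = 0 := by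
    refine Eq.trans (b := (S.algStep ε α x ⟨lam, lam, 1⟩).mu) ?_ h1
    simp [algStep]
  have hstep (s : S.AlgState) (hmu : s.mu = 0) (hl : s.lam = 0) :
      (S.algStep ε α x s).mu = 0 ∧ (S.algStep ε α x s).lam = 0 := by
    have h3 : (S.algStep ε α x s).mu = 0 := funext fun j => max_eq_left <| by
      rw [hl]
      simpa using h0 j
    refine ⟨h3, ?_⟩
    have h4 : (S.algStep ε α x s).lam = (S.algStep ε α x s).mu
      + ((s.theta - 1) / (S.algStep ε α x s).theta) • ((S.algStep ε α x s).mu - s.mu) := rfl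
    rw [h4, h3, hmu]
    simp
  have hiter : ((S.algStep ε α x)^[k + 1] ⟨lam, lam, 1⟩).mu = 0 ∧
      ((S.algStep ε α x)^[k + 1] ⟨lam, lam, 1⟩).lam = 0 := by
    clear hℓ
    induction k with
    | zero => exact ⟨h1, h2⟩
    | succ k ih =>
      rw [Function.iterate_succ_apply']
      exact hstep _ ih.1 ih.2
  exact hiter.2

end DMPC

lemma exists_pos_forall_le {ι : Type*} [Finite ι] (K : ι → ℝ) :
    ∃ M, 0 < M ∧ ∀ i, K i ≤ M :=
  ((eventually_gt_atTop 0).and (eventually_all.2 fun i => eventually_ge_atTop (K i))).exists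

lemma exists_pos_forall_ge {ι : Type*} [Finite ι] (r : ι → ℝ) (hr : ∀ i, 0 < r i) :
    ∃ s, 0 < s ∧ ∀ i, s ≤ r i := by
  obtain ⟨M, hM, h⟩ := exists_pos_forall_le fun i => (r i)⁻¹
  exact ⟨M⁻¹, by positivity, fun i => inv_le_of_inv_le₀ (hr i) (h i)⟩

lemma norm_le_sqrt_sum_sq {M : ℕ} {n : Fin M → ℕ} (x : ∀ i, Fin (n i) → ℝ) :
    ‖x‖ ≤ √(∑ i, ∑ a, x i a ^ 2) := by
  refine (pi_norm_le_iff_of_nonneg (Real.sqrt_nonneg _)).2 fun i =>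
    (pi_norm_le_iff_of_nonneg (Real.sqrt_nonneg _)).2 fun a => Real.abs_le_sqrt ?_
  exact (Finset.single_le_sum (f := fun a => x i a ^ 2) (fun _ _ => sq_nonneg _)
      (Finset.mem_univ a)).trans
    (Finset.single_le_sum (f := fun i => ∑ a, x i a ^ 2)
      (fun _ _ => Finset.sum_nonneg fun _ _ => sq_nonneg _) (Finset.mem_univ i))

lemma sqrt_sum_sq_le_norm {M : ℕ} {n : Fin M → ℕ} (x : ∀ i, Fin (n i) → ℝ) :
    √(∑ i, ∑ a, x i a ^ 2) ≤ (∑ i, (n i : ℝ) + 1) * ‖x‖ := by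
  refine Real.sqrt_le_iff.2 ⟨by positivity, ?_⟩
  have hn : 0 ≤ ∑ i, (n i : ℝ) := by positivity
  calc ∑ i, ∑ a, x i a ^ 2 ≤ ∑ i, ∑ _a : Fin (n i), ‖x‖ ^ 2 := by
        refine Finset.sum_le_sum fun i _ => Finset.sum_le_sum fun a _ => sq_le_sq' ?_ ?_
        · exact (abs_le.1 ((norm_le_pi_norm (x i) a).trans (norm_le_pi_norm x i))).1
        · exact (abs_le.1 ((norm_le_pi_norm (x i) a).trans (norm_le_pi_norm x i))).2
    _ = (∑ i, (n i : ℝ)) * ‖x‖ ^ 2 := by simp [Finset.sum_mul]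
    _ ≤ _ := by nlinarith [sq_nonneg ‖x‖, mul_nonneg hn (sq_nonneg ‖x‖),
        mul_nonneg (sq_nonneg (∑ i, (n i : ℝ))) (sq_nonneg ‖x‖)]

namespace DMPC

variable (S : DMPC)

/-! ### Estimates for the interconnection near the origin -/

lemma norm_le_stateNorm (x : S.State) : ‖x‖ ≤ S.stateNorm x := norm_le_sqrt_sum_sq x

lemma norm_le_inputNorm (u : S.Input) : ‖u‖ ≤ S.inputNorm u := norm_le_sqrt_sum_sq u

lemma norm_le_dualNorm (e : S.Dual) : ‖e‖ ≤ S.dualNorm e := by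
  refine (pi_norm_le_iff_of_nonneg (Real.sqrt_nonneg _)).2 fun j => Real.abs_le_sqrt ?_
  exact Finset.single_le_sum (f := fun j => e j ^ 2) (fun _ _ => sq_nonneg _)
    (Finset.mem_univ j)

lemma exists_stateNorm_le : ∃ K, 0 < K ∧ ∀ x : S.State, S.stateNorm x ≤ K * ‖x‖ :=
  ⟨_, by positivity, sqrt_sum_sq_le_norm⟩

lemma exists_dualNorm_le : ∃ K, 0 < K ∧ ∀ e : S.Dual, S.dualNorm e ≤ K * ‖e‖ := by
  refine ⟨Fintype.card (Fin S.p × Fin S.N) + 1, by positivity, fun e => ?_⟩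
  refine Real.sqrt_le_iff.2 ⟨by positivity, ?_⟩
  have hn : (0 : ℝ) ≤ Fintype.card (Fin S.p × Fin S.N) := by positivity
  calc ∑ j, e j ^ 2 ≤ ∑ _j : Fin S.p × Fin S.N, ‖e‖ ^ 2 := by
        refine Finset.sum_le_sum fun j _ => sq_le_sq' ?_ ?_
        · exact (abs_le.1 (norm_le_pi_norm e j)).1
        · exact (abs_le.1 (norm_le_pi_norm e j)).2
    _ = (Fintype.card (Fin S.p × Fin S.N) : ℝ) * ‖e‖ ^ 2 := by simp
    _ ≤ _ := by nlinarith [sq_nonneg ‖e‖, mul_nonneg hn (sq_nonneg ‖e‖),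
        mul_nonneg (sq_nonneg (Fintype.card (Fin S.p × Fin S.N) : ℝ)) (sq_nonneg ‖e‖)]

lemma exists_norm_localSol_le (hS : S.Assumptions) :
    ∃ K r, 0 < K ∧ 0 < r ∧ ∀ i x, ‖x‖ ≤ r → (S.Z i x).Nonempty ∧
      ∀ lam, ‖S.localSol i lam x‖ ≤ K * (‖x‖ + ‖lam‖) ∧
        ‖S.localSol i lam x - S.localSol i 0 x‖ ≤ K * ‖lam‖ := by
  choose K₁ r₁ hK₁ hr₁ h₁ using S.exists_norm_localSol_zero_le hS
  choose K₂ hK₂ h₂ using S.exists_norm_localSol_sub_le hS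
  choose r₂ hr₂ h₃ using S.exists_nonempty_Z hS
  obtain ⟨L₁, hL₁, hL₁'⟩ := exists_pos_forall_le K₁
  obtain ⟨L₂, hL₂, hL₂'⟩ := exists_pos_forall_le K₂
  obtain ⟨s₁, hs₁, hs₁'⟩ := exists_pos_forall_ge r₁ hr₁
  obtain ⟨s₂, hs₂, hs₂'⟩ := exists_pos_forall_ge r₂ hr₂
  refine ⟨L₁ + L₂, min s₁ s₂, by positivity, by positivity, fun i x hx => ?_⟩
  have hZ := h₃ i x ((hx.trans (min_le_right _ _)).trans (hs₂' i))
  refine ⟨hZ, fun lam => ?_⟩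
  have h4 : ‖S.localSol i 0 x‖ ≤ L₁ * ‖x‖ :=
    (h₁ i x ((hx.trans (min_le_left _ _)).trans (hs₁' i))).trans (by gcongr; exact hL₁' i)
  have h5 : ‖S.localSol i lam x - S.localSol i 0 x‖ ≤ L₂ * ‖lam‖ := by
    have := h₂ i x hZ lam 0
    rw [sub_zero] at this
    exact this.trans (by gcongr; exact hL₂' i)
  have h6 := norm_le_norm_add_norm_sub' (S.localSol i lam x) (S.localSol i 0 x)
  have h7 : 0 ≤ L₁ * ‖lam‖ := by positivity
  have h8 : 0 ≤ L₂ * ‖x‖ := by positivity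
  constructor <;> nlinarith

lemma norm_stage_zero_le {i : Fin S.M} (v : S.Traj i) :
    ‖fun a => v (a, ⟨0, S.N_pos⟩)‖ ≤ ‖v‖ :=
  (pi_norm_le_iff_of_nonneg (norm_nonneg _)).2 fun _ => norm_le_pi_norm v _

lemma exists_norm_q_le (hS : S.Assumptions) :
    ∃ K r, 0 < K ∧ 0 < r ∧ ∀ x : S.State, ‖x‖ ≤ r →
      ‖S.q 0 x‖ ≤ K * ‖x‖ ∧ ∀ lam, ‖S.q lam x - S.q 0 x‖ ≤ K * ‖lam‖ := by
  obtain ⟨K, r, hK, hr, h⟩ := S.exists_norm_localSol_le hS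
  refine ⟨K, r, hK, hr, fun x hx => ⟨?_, fun lam => ?_⟩⟩
  · refine (pi_norm_le_iff_of_nonneg (by positivity)).2 fun i => ?_
    have h1 := ((h i (x i) ((norm_le_pi_norm x i).trans hx)).2 0).1
    rw [norm_zero, add_zero] at h1
    refine (S.norm_stage_zero_le _).trans (h1.trans ?_)
    gcongr
    exact norm_le_pi_norm x i
  · refine (pi_norm_le_iff_of_nonneg (by positivity)).2 fun i => ?_
    have h1 := ((h i (x i) ((norm_le_pi_norm x i).trans hx)).2 lam).2
    exact (S.norm_stage_zero_le (S.localSol i lam (x i) - S.localSol i 0 (x i))).trans h1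

/-- The coupling terms are of the size of the state and the dual variable. -/
lemma exists_norm_coupling_le (hS : S.Assumptions) :
    ∃ K r, 0 < K ∧ 0 < r ∧ ∀ x : S.State, ‖x‖ ≤ r → ∀ lam : S.Dual,
      ‖∑ i, (S.F i *ᵥ x i + S.E i *ᵥ S.localSol i lam (x i))‖ ≤ K * (‖x‖ + ‖lam‖) := by
  obtain ⟨K, r, hK, hr, h⟩ := S.exists_norm_localSol_le hS
  choose KF hKF hF using fun i => exists_norm_mulVec_le (S.F i)
  choose KE hKE hE using fun i => exists_norm_mulVec_le (S.E i)
  have hnn : 0 ≤ ∑ i, (KF i + KE i * K) :=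
    Finset.sum_nonneg fun i _ => add_nonneg (hKF i).le (mul_nonneg (hKE i).le hK.le)
  refine ⟨∑ i, (KF i + KE i * K) + 1, r, by positivity, hr, fun x hx lam => ?_⟩
  calc _ ≤ ∑ i, (KF i + KE i * K) * (‖x‖ + ‖lam‖) := by
        refine (norm_sum_le _ _).trans (Finset.sum_le_sum fun i _ => ?_)
        have hxi := norm_le_pi_norm x i
        have h1 := ((h i (x i) (hxi.trans hx)).2 lam).1
        have h2 : ‖S.F i *ᵥ x i‖ ≤ KF i * (‖x‖ + ‖lam‖) := (hF i _).trans <| by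
          have := hKF i
          gcongr
          linarith [norm_nonneg lam]
        have h3 : ‖S.E i *ᵥ S.localSol i lam (x i)‖ ≤ KE i * (K * (‖x‖ + ‖lam‖)) :=
          (hE i _).trans <| by
            have := hKE i
            gcongr
            exact h1.trans (by gcongr)
        exact (norm_add_le _ _).trans (by linarith)
    _ ≤ _ := by
        rw [← Finset.sum_mul]
        gcongr
        linarith

/-- Near the origin the coupling constraints hold with a margin, so that the dual solution is zero
and a single round of the algorithm returns it. -/
lemma exists_dualSol_algo_eq_zero (hS : S.Assumptions) :
    ∃ r, 0 < r ∧ (∀ x : S.State, ‖x‖ ≤ r → ∀ ε, 0 < ε → S.dualSol ε x = 0) ∧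
      ∀ ε α, 0 < ε → 0 < α → ∃ s, 0 < s ∧ ∀ (x : S.State) (lam : S.Dual), ‖x‖ ≤ s → ‖lam‖ ≤ s →
        ∀ ℓ, 0 < ℓ → S.algo ε α ℓ lam x = 0 := by
  obtain ⟨K, r, hK, hr, h⟩ := S.exists_norm_coupling_le hS
  obtain ⟨_, r', _, hr', hZ⟩ := S.exists_norm_localSol_le hS
  obtain ⟨m, hm, hb⟩ := exists_pos_forall_ge S.b fun j => hS.bbar_pos j.1
  have hcoup (x : S.State) (hx : ‖x‖ ≤ r) (lam : S.Dual) (j) :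
      (∑ i, (S.F i *ᵥ x i + S.E i *ᵥ S.localSol i lam (x i))) j ≤ K * (‖x‖ + ‖lam‖) :=
    (le_abs_self _).trans ((norm_le_pi_norm _ j).trans (h x hx lam))
  refine ⟨min (min r r') (m / K), by positivity, fun x hx ε hε => ?_, fun ε α hε hα => ?_⟩
  · simp only [le_min_iff, le_div_iff₀ hK] at hx
    refine S.dualSol_eq_zero hS hε
      (fun i => (hZ i _ ((norm_le_pi_norm x i).trans hx.1.2)).1) fun j => ?_
    have := hcoup x hx.1.1 0 j
    rw [norm_zero, add_zero, Finset.sum_add_distrib] at this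
    linarith [hb j]
  · set s := min r (α * m / (1 + 2 * α * K + α * ε))
    have hs : 0 < s := by positivity
    have hs1 : s * (1 + 2 * α * K + α * ε) ≤ α * m :=
      (le_div_iff₀ (by positivity)).1 (min_le_right _ _)
    refine ⟨s, hs, fun x lam hx hlam ℓ hℓ => S.algo_eq_zero ?_ ?_ hℓ⟩
    · intro j
      have h1 := hcoup x (hx.trans (min_le_left _ _)) lam j
      have h2 : |lam j| ≤ s := (norm_le_pi_norm lam j).trans hlam
      have h3 : K * (‖x‖ + ‖lam‖) ≤ K * (s + s) := by gcongr
      simp only [Pi.add_apply, Pi.smul_apply, Pi.sub_apply, smul_eq_mul, Pi.zero_apply]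
      have h4 := abs_le.1 h2
      have h5 : α * ((∑ i, (S.F i *ᵥ x i + S.E i *ᵥ S.localSol i lam (x i))) j - S.b j
          - ε * lam j) ≤ α * (K * (s + s) - m + ε * s) := by
        have : ε * -s ≤ ε * lam j := by
          gcongr
          exact h4.1
        gcongr
        linarith [hb j]
      linarith
    · intro j
      have h1 := hcoup x (hx.trans (min_le_left _ _)) 0 j
      rw [norm_zero, add_zero] at h1
      have h3 : K * ‖x‖ ≤ K * s := by gcongr
      simp only [Pi.smul_apply, Pi.sub_apply, smul_eq_mul, Pi.zero_apply]
      have h4 : α * (K * s) ≤ α * m := by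
        have : 0 ≤ s * (1 + α * K + α * ε) := by positivity
        linarith
      have h5 := le_of_mul_le_mul_left h4 hα
      exact mul_nonpos_of_nonneg_of_nonpos hα.le (by linarith [hb j])

lemma exists_norm_plant_le :
    ∃ K, 0 < K ∧ ∀ x u d, ‖S.plant x u d‖ ≤ K * (‖x‖ + ‖u‖ + ‖d‖) := by
  choose KA hKA hA using fun i => exists_norm_mulVec_le (S.A i)
  choose KB hKB hB using fun i => exists_norm_mulVec_le (S.B i)
  obtain ⟨K₁, hK₁, hK₁'⟩ := exists_pos_forall_le KA
  obtain ⟨K₂, hK₂, hK₂'⟩ := exists_pos_forall_le KB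
  refine ⟨K₁ + K₂ + 1, by positivity, fun x u d => ?_⟩
  refine (pi_norm_le_iff_of_nonneg (by positivity)).2 fun i => ?_
  have h1 : ‖S.A i *ᵥ x i‖ ≤ K₁ * ‖x‖ :=
    (hA i _).trans (mul_le_mul (hK₁' i) (norm_le_pi_norm x i) (norm_nonneg _) hK₁.le)
  have h2 : ‖S.B i *ᵥ u i‖ ≤ K₂ * ‖u‖ :=
    (hB i _).trans (mul_le_mul (hK₂' i) (norm_le_pi_norm u i) (norm_nonneg _) hK₂.le)
  have h3 : ‖d i‖ ≤ ‖d‖ := norm_le_pi_norm d i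
  have h4 : ‖S.plant x u d i‖ ≤ _ := norm_add₃_le
  have := norm_nonneg x
  have := norm_nonneg u
  have := norm_nonneg d
  nlinarith [mul_nonneg hK₁.le (norm_nonneg u), mul_nonneg hK₁.le (norm_nonneg d),
    mul_nonneg hK₂.le (norm_nonneg x), mul_nonneg hK₂.le (norm_nonneg d)]

lemma plant_add (x : S.State) (u du : S.Input) (d : S.State) :
    S.plant x (u + du) d = S.plant x u 0 + S.plant 0 du d := by
  ext1 i
  simp only [plant, Pi.add_apply, mulVec_add, Pi.zero_apply, mulVec_zero, add_zero, zero_add]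
  abel

/-- The input-to-state Lyapunov function of the plant: the sum of the roots of the decoupled value
functions. -/
noncomputable def lyapunov (x : S.State) : ℝ := ∑ i, S.valueRoot i (x i)

lemma lyapunov_nonneg (x : S.State) : 0 ≤ S.lyapunov x :=
  Finset.sum_nonneg fun i _ => S.valueRoot_nonneg i (x i)

/-- The Lyapunov function is comparable with the norm and satisfies a linear dissipation
inequality; local subadditivity turns additive perturbations into additive terms. -/
lemma exists_lyapunov (hS : S.Assumptions) :
    ∃ K r, 2 ≤ K ∧ 0 < r ∧ (∀ x, ‖x‖ ≤ K * S.lyapunov x) ∧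
      (∀ x, ‖x‖ ≤ r → S.lyapunov x ≤ K * ‖x‖) ∧
      ∀ x du d, ‖x‖ ≤ r → ‖du‖ ≤ r → ‖d‖ ≤ r →
        S.lyapunov (S.plant x (S.q 0 x + du) d)
          ≤ (1 - 1 / K) * S.lyapunov x + K * (‖du‖ + ‖d‖) := by
  choose K₁ hK₁ h₁ using S.exists_norm_le_valueRoot hS
  choose K₂ r₂ hK₂ hr₂ h₂ using S.exists_valueRoot_le hS
  choose r₃ hr₃ h₃ using S.exists_valueRoot_add_le hS
  choose K₄ r₄ hr₄ h₄ using S.exists_valueRoot_contract hS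
  obtain ⟨K₅, r₅, hK₅, hr₅, h₅⟩ := S.exists_norm_q_le hS
  obtain ⟨K₆, hK₆, h₆⟩ := S.exists_norm_plant_le
  obtain ⟨L₁, hL₁, hL₁'⟩ := exists_pos_forall_le K₁
  obtain ⟨L₄, hL₄, hL₄'⟩ := exists_pos_forall_le K₄
  obtain ⟨s₂, hs₂, hs₂'⟩ := exists_pos_forall_ge r₂ hr₂
  obtain ⟨s₃, hs₃, hs₃'⟩ := exists_pos_forall_ge r₃ hr₃
  obtain ⟨s₄, hs₄, hs₄'⟩ := exists_pos_forall_ge r₄ hr₄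
  set L₂ := ∑ i, K₂ i
  have hL₂ : 0 ≤ L₂ := Finset.sum_nonneg fun i _ => (hK₂ i).le
  have hupper (x : S.State) (hx : ‖x‖ ≤ s₂) : S.lyapunov x ≤ L₂ * ‖x‖ := by
    rw [lyapunov, Finset.sum_mul]
    refine Finset.sum_le_sum fun i _ => ?_
    have hxi := norm_le_pi_norm x i
    refine (h₂ i _ (hxi.trans (hx.trans (hs₂' i)))).trans ?_
    have := hK₂ i
    gcongr
  set K := 2 + L₁ + L₂ + L₄ + L₂ * K₆
  have hLK : 0 ≤ L₂ * K₆ := by positivity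
  -- `t` bounds both the nominal successor state and the perturbation
  set t := min s₂ s₃
  have ht : 0 < t := by positivity
  refine ⟨K, min (min s₂ s₄) (min r₅ (min (t / (K₆ * (1 + K₅))) (t / (2 * K₆)))), by linarith,
    by positivity, fun x => ?_, fun x hx => ?_, fun x du d hx hdu hd => ?_⟩
  · have hWx := S.lyapunov_nonneg x
    refine (pi_norm_le_iff_of_nonneg (mul_nonneg (by linarith) hWx)).2 fun i => ?_
    have h0 := S.valueRoot_nonneg i (x i)
    have hsingle : S.valueRoot i (x i) ≤ S.lyapunov x :=
      Finset.single_le_sum (f := fun i => S.valueRoot i (x i))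
        (fun i _ => S.valueRoot_nonneg i _) (Finset.mem_univ i)
    refine (h₁ i (x i)).1.trans (mul_le_mul ?_ hsingle h0 (by linarith))
    linarith [hL₁' i]
  · simp only [le_min_iff] at hx
    exact (hupper x hx.1.1).trans (by gcongr; linarith)
  · simp only [le_min_iff] at hx hdu hd
    have hnom : ‖S.plant x (S.q 0 x) 0‖ ≤ t := by
      have h7 := h₆ x (S.q 0 x) 0
      have h8 := (h₅ x hx.2.1).1
      have h9 := (le_div_iff₀ (by positivity)).1 hx.2.2.1
      rw [norm_zero, add_zero] at h7
      refine h7.trans (le_trans ?_ h9)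
      rw [show ‖x‖ * (K₆ * (1 + K₅)) = K₆ * (‖x‖ + K₅ * ‖x‖) by ring]
      gcongr
    have hpert' : ‖S.plant 0 du d‖ ≤ K₆ * (‖du‖ + ‖d‖) := by
      simpa using h₆ 0 du d
    have hpert : ‖S.plant 0 du d‖ ≤ t := by
      have h7 := (le_div_iff₀ (by positivity)).1 hdu.2.2.2
      have h8 := (le_div_iff₀ (by positivity)).1 hd.2.2.2
      linarith
    have hadd : S.lyapunov (S.plant x (S.q 0 x + du) d)
        ≤ S.lyapunov (S.plant x (S.q 0 x) 0) + S.lyapunov (S.plant 0 du d) := by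
      rw [plant_add, lyapunov, lyapunov, lyapunov, ← Finset.sum_add_distrib]
      refine Finset.sum_le_sum fun i _ => h₃ i _ _ ?_ ?_
      · exact (norm_le_pi_norm _ i).trans (hnom.trans ((min_le_right _ _).trans (hs₃' i)))
      · exact (norm_le_pi_norm _ i).trans (hpert.trans ((min_le_right _ _).trans (hs₃' i)))
    have hcontr : S.lyapunov (S.plant x (S.q 0 x) 0) ≤ (1 - 1 / K) * S.lyapunov x := by
      rw [lyapunov, lyapunov, Finset.mul_sum]
      refine Finset.sum_le_sum fun i _ => ?_
      have h7 := h₄ i K (by linarith [hL₄' i]) (x i)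
        ((norm_le_pi_norm x i).trans (hx.1.2.trans (hs₄' i)))
      simp only [plant, Pi.zero_apply, add_zero]
      exact h7
    have hW : S.lyapunov (S.plant 0 du d) ≤ K * (‖du‖ + ‖d‖) := by
      refine (hupper _ (hpert.trans (min_le_left _ _))).trans ?_
      calc _ ≤ L₂ * (K₆ * (‖du‖ + ‖d‖)) := by gcongr
        _ = L₂ * K₆ * (‖du‖ + ‖d‖) := by ring
        _ ≤ _ := by
          gcongr
          linarith
    linarith

end DMPC

/-! ### Linear dissipation inequalities and comparison functions -/

/-- A scalar comparison principle: a dissipation inequality that is only available below the level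
`v` keeps trajectories below that level and gives an exponential bound. -/
lemma le_of_local_dissipation {V : ℕ → ℝ} {K v g : ℝ} (hK : 1 < K) (h0 : V 0 ≤ v)
    (hg : K * g ≤ v) (hg0 : 0 ≤ g) (hstep : ∀ t, V t ≤ v → V (t + 1) ≤ (1 - 1 / K) * V t + g)
    (t : ℕ) : V t ≤ v ∧ V t ≤ (1 - 1 / K) ^ t * V 0 + K * g := by
  have hK0 : 0 < K := by linarith
  have hθ : 0 ≤ 1 - 1 / K := by
    rw [sub_nonneg, div_le_one hK0]
    exact hK.le
  have hKK : 1 / K * K = 1 := by field_simp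
  induction t with
  | zero => exact ⟨h0, by simpa using by positivity⟩
  | succ t ih =>
    have h1 := hstep t ih.1
    constructor
    · have h2 : (1 - 1 / K) * V t ≤ (1 - 1 / K) * v := by gcongr; exact ih.1
      have h3 : 1 / K * (K * g) ≤ 1 / K * v := by gcongr
      rw [← mul_assoc, hKK, one_mul] at h3
      linarith
    · have h2 : (1 - 1 / K) * V t ≤ (1 - 1 / K) * ((1 - 1 / K) ^ t * V 0 + K * g) := by
        gcongr
        exact ih.2
      have h3 : (1 - 1 / K) * (K * g) = K * g - g := by
        linear_combination (-g) * hKK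
      rw [pow_succ']
      linarith

lemma classKL_exponential {a θ : ℝ} (ha : 0 < a) (h0 : 0 < θ) (h1 : θ < 1) :
    ClassKL fun r s => a * θ ^ s * r := by
  refine ⟨fun s _ => ⟨by fun_prop, fun r _ r' _ h => ?_, by simp⟩, fun r hr => ⟨?_, ?_, ?_⟩⟩
  · have : 0 < a * θ ^ s := by positivity
    exact mul_lt_mul_of_pos_left h this
  · exact ((continuous_const.mul (Real.continuous_const_rpow h0.ne')).mul
      continuous_const).continuousOn
  · intro s _ s' _ h
    have := Real.rpow_lt_rpow_of_exponent_gt h0 h1 h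
    simp only
    gcongr
  · have := ((tendsto_rpow_atTop_of_base_lt_one θ (by linarith) h1).const_mul a).mul_const r
    simpa using this

lemma classK_linear {a : ℝ} (ha : 0 < a) : ClassK fun r => a * r :=
  ⟨by fun_prop, fun _ _ _ _ h => mul_lt_mul_of_pos_left h ha, by simp⟩

namespace DMPC

variable (S : DMPC)

/-! ### Input-to-state stability -/

/-- The plant subsystem is input-to-state stable with linear gains. Any threshold works: near the
origin the control law does not depend on `ε`. -/
lemma isPlantThreshold (hS : S.Assumptions) (εt : ℝ) : S.IsPlantThreshold εt := by
  obtain ⟨K, r, hK, hr, hlow, hup, hdiss⟩ := S.exists_lyapunov hS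
  obtain ⟨r₁, hr₁, hdual, -⟩ := S.exists_dualSol_algo_eq_zero hS
  obtain ⟨r₂, hr₂, hfeas⟩ := S.exists_feasible_nhds hS
  obtain ⟨c, hc, hnorm⟩ := S.exists_stateNorm_le
  have hK0 : 0 < K := by linarith
  have hθ0 : 0 < 1 - 1 / K := by
    rw [sub_pos, div_lt_one hK0]
    linarith
  have hθ1 : 1 - 1 / K < 1 := by
    have : 0 < 1 / K := by positivity
    linarith
  set s := min r (min r₁ r₂)
  have hs : 0 < s := by positivity
  refine ⟨c * K ^ 3, by positivity, c * K ^ 3, by positivity,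
    fun ρ t => c * K ^ 2 * (1 - 1 / K) ^ t * ρ, classKL_exponential (by positivity) hθ0 hθ1,
    fun ε hε _ => ?_⟩
  -- on the level set `s / K` of the Lyapunov function all local estimates are available, and the
  -- radius makes both the initial value and `K` times the perturbation at most `s / K`
  refine ⟨min r (s / (2 * K ^ 3)), by positivity, fun x du d htraj hx0 hdu hd t => ?_⟩
  have hK2 : 0 < 2 * K ^ 3 := by positivity
  have hduB (t) : S.inputNorm (du t) ≤ ⨆ k, S.inputNorm (du k) :=
    le_ciSup (f := fun k => S.inputNorm (du k)) ⟨_, forall_mem_range.2 hdu⟩ t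
  have hdB (t) : S.stateNorm (d t) ≤ ⨆ k, S.stateNorm (d k) :=
    le_ciSup (f := fun k => S.stateNorm (d k)) ⟨_, forall_mem_range.2 hd⟩ t
  have hDu := ciSup_le hdu
  have hDd := ciSup_le hd
  set Du := ⨆ k, S.inputNorm (du k)
  set Dd := ⨆ k, S.stateNorm (d k)
  have hDu0 : 0 ≤ Du := (Real.sqrt_nonneg _).trans (hduB 0)
  have hDd0 : 0 ≤ Dd := (Real.sqrt_nonneg _).trans (hdB 0)
  have hx0n := (S.norm_le_stateNorm (x 0)).trans hx0
  have hV0 : S.lyapunov (x 0) ≤ K * ‖x 0‖ := hup _ (hx0n.trans (min_le_left _ _))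
  have e1 := (le_div_iff₀ hK2).1 (hx0n.trans (min_le_right _ _))
  have e2 := (le_div_iff₀ hK2).1 (hDu.trans (min_le_right _ _))
  have e3 := (le_div_iff₀ hK2).1 (hDd.trans (min_le_right _ _))
  have hsmall (y : S.State) (hy : S.lyapunov y ≤ s / K) : ‖y‖ ≤ s := by
    have := (le_div_iff₀ hK0).1 hy
    exact (hlow y).trans (by linarith)
  have hK3 : K ^ 2 ≤ 2 * K ^ 3 := by nlinarith [sq_nonneg K]
  obtain ⟨hv, hb⟩ := le_of_local_dissipation (V := fun t => S.lyapunov (x t)) (K := K)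
    (v := s / K) (g := K * (Du + Dd)) (by linarith)
    (by
      rw [le_div_iff₀ hK0]
      nlinarith [norm_nonneg (x 0), mul_le_mul_of_nonneg_left hK3 (norm_nonneg (x 0))])
    (by
      rw [le_div_iff₀ hK0]
      linarith)
    (by positivity)
    (fun t ht => by
      have hxt := hsmall (x t) ht
      have hkap : S.kappa ε (x t) = S.q 0 (x t) := by
        rw [kappa, hdual (x t) (hxt.trans ((min_le_right _ _).trans (min_le_left _ _))) ε hε]
      have h1 := hdiss (x t) (du t) (d t) (hxt.trans (min_le_left _ _))
        ((S.norm_le_inputNorm _).trans ((hdu t).trans (min_le_left _ _)))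
        ((S.norm_le_stateNorm _).trans ((hd t).trans (min_le_left _ _)))
      rw [htraj t, hkap]
      refine h1.trans ?_
      gcongr
      · exact (S.norm_le_inputNorm _).trans (hduB t)
      · exact (S.norm_le_stateNorm _).trans (hdB t)) t
  refine ⟨hfeas _ ((hsmall _ hv).trans ((min_le_right _ _).trans (min_le_right _ _))), ?_⟩
  have hV0' : S.lyapunov (x 0) ≤ K * S.stateNorm (x 0) :=
    hV0.trans (by gcongr; exact S.norm_le_stateNorm _)
  simp only [Real.rpow_natCast]
  calc S.stateNorm (x t) ≤ c * (K * S.lyapunov (x t)) := (hnorm _).trans (by gcongr; exact hlow _)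
    _ ≤ c * (K * ((1 - 1 / K) ^ t * (K * S.stateNorm (x 0)) + K * (K * (Du + Dd)))) := by
        gcongr
        refine hb.trans ?_
        gcongr
    _ = _ := by ring

/-- The interconnection is input-to-state stable, with the Lyapunov function
`lyapunov x + k * ‖e‖`; the second term vanishes after one step. -/
lemma isClosedLoopLISS (hS : S.Assumptions) {ε α : ℝ} (hε : 0 < ε) (hα : 0 < α) {ℓ : ℕ}
    (hℓ : 0 < ℓ) : S.IsClosedLoopLISS ε α ℓ := by
  obtain ⟨K, r, hK, hr, hlow, hup, hdiss⟩ := S.exists_lyapunov hS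
  obtain ⟨r₁, hr₁, hdual, halg⟩ := S.exists_dualSol_algo_eq_zero hS
  obtain ⟨r₃, hr₃, halg⟩ := halg ε α hε hα
  obtain ⟨r₂, hr₂, hfeas⟩ := S.exists_feasible_nhds hS
  obtain ⟨C, r₄, hC, hr₄, hq⟩ := S.exists_norm_q_le hS
  obtain ⟨c₁, hc₁, hnorm⟩ := S.exists_stateNorm_le
  obtain ⟨c₂, hc₂, hdnorm⟩ := S.exists_dualNorm_le
  have hK0 : 0 < K := by linarith
  have hKinv : 1 / K ≤ 1 / 2 := one_div_le_one_div_of_le two_pos hK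
  have hθ0 : 0 < 1 - 1 / K := by linarith
  have hθ1 : 1 - 1 / K < 1 := by
    have : 0 < 1 / K := by positivity
    linarith
  -- the weight of the error is large enough to absorb the input error it causes in one step,
  -- since the error itself vanishes after that step
  set k := 2 * K * (C + 1)
  have hk : 0 < k := by positivity
  have hkC : k * (1 - 1 / K) ≥ K * C := by
    have : K * (C + 1) ≤ k * (1 - 1 / K) := by
      have := mul_le_mul_of_nonneg_left (show (1 : ℝ) / 2 ≤ 1 - 1 / K by linarith) hk.le
      linarith
    linarith
  have hk1 : 1 ≤ k := by nlinarith
  set s := min r (min (min r₁ r₂) (min r₃ (min r₄ (r / C))))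
  have hs : 0 < s := by positivity
  have hsr : s ≤ r := min_le_left _ _
  have hs1 : s ≤ r₁ := (min_le_right _ _).trans ((min_le_left _ _).trans (min_le_left _ _))
  have hs2 : s ≤ r₂ := (min_le_right _ _).trans ((min_le_left _ _).trans (min_le_right _ _))
  have hs3 : s ≤ r₃ := (min_le_right _ _).trans ((min_le_right _ _).trans (min_le_left _ _))
  have hs4 : s ≤ r₄ := (min_le_right _ _).trans
    ((min_le_right _ _).trans ((min_le_right _ _).trans (min_le_left _ _)))
  have hs5 : s ≤ r / C := (min_le_right _ _).trans
    ((min_le_right _ _).trans ((min_le_right _ _).trans (min_le_right _ _)))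
  set c := c₁ * K + c₂
  have hc : 0 < c := by positivity
  refine ⟨min r (s / (K * (K + k) + K ^ 3)), by positivity,
    fun ρ t => c * (K + k) * (1 - 1 / K) ^ t * ρ, fun ρ => c * K ^ 2 * ρ,
    classKL_exponential (by positivity) hθ0 hθ1, classK_linear (by positivity),
    fun x e d htraj h0 hd t => ?_⟩
  obtain ⟨hx, he⟩ := htraj
  have hden : 0 < K * (K + k) + K ^ 3 := by positivity
  have hdB (t) : S.stateNorm (d t) ≤ ⨆ k, S.stateNorm (d k) :=
    le_ciSup (f := fun k => S.stateNorm (d k)) ⟨_, forall_mem_range.2 hd⟩ t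
  have hDd := ciSup_le hd
  set Dd := ⨆ k, S.stateNorm (d k)
  have hDd0 : 0 ≤ Dd := (Real.sqrt_nonneg _).trans (hdB 0)
  set p := S.pairNorm (x 0) (e 0)
  have hp0 : 0 ≤ p := Real.sqrt_nonneg _
  have hxp : ‖x 0‖ ≤ p := (S.norm_le_stateNorm _).trans
    (Real.le_sqrt_of_sq_le (by linarith [sq_nonneg (S.dualNorm (e 0))]))
  have hep : ‖e 0‖ ≤ p := (S.norm_le_dualNorm _).trans
    (Real.le_sqrt_of_sq_le (by linarith [sq_nonneg (S.stateNorm (x 0))]))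
  have e1 := (le_div_iff₀ hden).1 (h0.trans (min_le_right _ _))
  have e2 := (le_div_iff₀ hden).1 (hDd.trans (min_le_right _ _))
  have hsmall (y : S.State) (hy : S.lyapunov y ≤ s / K) : ‖y‖ ≤ s := by
    have := (le_div_iff₀ hK0).1 hy
    exact (hlow y).trans (by linarith)
  have hV0 : S.lyapunov (x 0) + k * ‖e 0‖ ≤ (K + k) * p := by
    have h1 := hup _ (hxp.trans (h0.trans (min_le_left _ _)))
    have h2 : K * ‖x 0‖ ≤ K * p := by gcongr
    have h3 : k * ‖e 0‖ ≤ k * p := by gcongr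
    linarith
  have hdist : K * (K * Dd) ≤ s / K := by
    rw [le_div_iff₀ hK0]
    have : 0 ≤ Dd * (K * (K + k)) := by positivity
    linarith
  obtain ⟨hv, hb⟩ := le_of_local_dissipation (V := fun t => S.lyapunov (x t) + k * ‖e t‖) (K := K)
    (v := s / K) (g := K * Dd) (by linarith)
    (by
      rw [le_div_iff₀ hK0]
      have : 0 ≤ p * K ^ 3 := by positivity
      have := mul_le_mul_of_nonneg_right hV0 hK0.le
      linarith)
    hdist (by positivity)
    (fun t ht => by
      have hWt := S.lyapunov_nonneg (x t)
      have hxt : ‖x t‖ ≤ s := hsmall (x t) (by linarith [mul_nonneg hk.le (norm_nonneg (e t))])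
      have het : ‖e t‖ ≤ s := by
        have h1 : ‖e t‖ ≤ k * ‖e t‖ := le_mul_of_one_le_left (norm_nonneg _) hk1
        have h2 : s / K ≤ s := div_le_self hs.le (by linarith)
        linarith
      have hdt : ‖d t‖ ≤ Dd := (S.norm_le_stateNorm _).trans (hdB t)
      have hdz := hdual (x t) (hxt.trans hs1) ε hε
      have hkap : S.kappa ε (x t) = S.q 0 (x t) := by rw [kappa, hdz]
      have hdu : ‖S.h₂ ε (e t) (x t)‖ ≤ C * ‖e t‖ := by
        rw [h₂, hdz, add_zero]
        exact (hq (x t) (hxt.trans hs4)).2 (e t)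
      have hdur : ‖S.h₂ ε (e t) (x t)‖ ≤ r := by
        refine hdu.trans ?_
        have := (le_div_iff₀ hC).1 (het.trans hs5)
        linarith
      have hnext : S.lyapunov (x (t + 1)) ≤ (1 - 1 / K) * (S.lyapunov (x t) + k * ‖e t‖)
          + K * Dd := by
        have h1 := hdiss (x t) _ (d t) (hxt.trans hsr) hdur
          ((S.norm_le_stateNorm _).trans ((hd t).trans (min_le_left _ _)))
        rw [hx t, hkap]
        refine h1.trans ?_
        have h2 : K * (‖S.h₂ ε (e t) (x t)‖ + ‖d t‖) ≤ K * (C * ‖e t‖ + Dd) := by gcongr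
        have h3 : K * C * ‖e t‖ ≤ k * (1 - 1 / K) * ‖e t‖ := by gcongr
        linarith
      have hxt1 : ‖x (t + 1)‖ ≤ s := by
        refine hsmall _ (hnext.trans ?_)
        have h1 : (1 - 1 / K) * (S.lyapunov (x t) + k * ‖e t‖) ≤ (1 - 1 / K) * (s / K) := by
          gcongr
        have h2 : K * Dd ≤ 1 / K * (s / K) := by
          rw [one_div, ← div_eq_inv_mul, le_div_iff₀ hK0]
          linarith
        linarith
      have hsucc : x t + S.h₁ ε (x t) (S.h₂ ε (e t) (x t)) (d t) = x (t + 1) := by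
        rw [h₁, ← hx t]
        abel
      have he1 : e (t + 1) = 0 := by
        rw [he t, errStep, hsucc, hdz, add_zero, hdual _ (hxt1.trans hs1) ε hε, sub_zero]
        exact halg _ _ (hxt1.trans hs3) (het.trans hs3) ℓ hℓ
      rw [he1, norm_zero, mul_zero, add_zero]
      exact hnext) t
  have hWt := S.lyapunov_nonneg (x t)
  have hke := mul_nonneg hk.le (norm_nonneg (e t))
  refine ⟨hfeas _ ((hsmall _ (by linarith)).trans hs2), ?_⟩
  have hpair : S.pairNorm (x t) (e t) ≤ S.stateNorm (x t) + S.dualNorm (e t) := by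
    have h1 : 0 ≤ S.stateNorm (x t) := Real.sqrt_nonneg _
    have h2 : 0 ≤ S.dualNorm (e t) := Real.sqrt_nonneg _
    refine Real.sqrt_le_iff.2 ⟨by positivity, ?_⟩
    nlinarith
  have h5 : S.stateNorm (x t) ≤ c₁ * (K * (S.lyapunov (x t) + k * ‖e t‖)) := by
    refine (hnorm _).trans ?_
    gcongr
    refine (hlow _).trans ?_
    gcongr
    linarith
  have h6 : S.dualNorm (e t) ≤ c₂ * (S.lyapunov (x t) + k * ‖e t‖) := by
    refine (hdnorm _).trans ?_
    gcongr
    have := le_mul_of_one_le_left (norm_nonneg (e t)) hk1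
    linarith
  simp only [Real.rpow_natCast]
  calc S.pairNorm (x t) (e t) ≤ c * (S.lyapunov (x t) + k * ‖e t‖) := by
        refine hpair.trans ((add_le_add h5 h6).trans_eq ?_)
        ring
    _ ≤ c * ((1 - 1 / K) ^ t * ((K + k) * p) + K * (K * Dd)) := by
        refine mul_le_mul_of_nonneg_left (hb.trans ?_) hc.le
        gcongr
    _ = _ := by ring

end DMPC

theorem mainTheorem3 (S : DMPC) (hS : S.Assumptions) :
    ∃ εt : ℝ, 0 < εt ∧ S.IsPlantThreshold εt ∧
      ∀ ε : ℝ, 0 < ε → ε ≤ εt →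
        ∀ α : ℝ, 0 < α → α < 1 / S.lipConst ε →
          ∃ ℓstar : ℕ, 0 < ℓstar ∧
            ∀ ℓ : ℕ, 2 / √(α * ε) - 1 < (ℓ : ℝ) → ℓstar ≤ ℓ → S.IsClosedLoopLISS ε α ℓ :=
  ⟨1, one_pos, S.isPlantThreshold hS 1, fun _ hε _ _ hα _ =>
    ⟨1, one_pos, fun _ _ hℓ => S.isClosedLoopLISS hS hε hα hℓ⟩⟩
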